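/- Let $N$ be a connected, simply connected Lie group whose Lie algebra $\mathfrak n$ is 2-step nilpotent (all double brackets vanish), with a left-invariant pseudoriemannian metric, i.e. a nondegenerate symmetric bilinear form $\langle\,,\rangle$ of arbitrary signature on $\mathfrak n$, extended by left translations. Assume that $\langle\,,\rangle$ is nondegenerate on the center $\mathfrak z$ of $\mathfrak n$, and put $\mathfrak v=\mathfrak z^\perp$, so that $\mathfrak n=\mathfrak z\oplus\mathfrak v$. For $z\in\mathfrak z$ let $J_z:\mathfrak v\to\mathfrak v$ be the linear map with $\langle J_zx,y\rangle=\langle z,[x,y]\rangle$ for all $x,y\in\mathfrak v$. Let $\gamma:\mathbb R\to N$ be a geodesic with $\gamma(0)=1$ and $\dot\gamma(0)=z_0+x_0$, where $z_0\in\mathfrak z$ and $x_0\in\mathfrak v$, and put $J=J_{z_0}$. For $t\neq0$, the point $\gamma(t)$ is conjugate to $\gamma(0)$ along $\gamma$ if there is a nontrivial Jacobi field $Y$ along $\gamma$ with $Y(0)=Y(t)=0$; its multiplicity $\mathrm{mult}_{cp}(t)$ is the dimension of the space of all Jacobi fields along $\gamma$ that vanish at $0$ and $t$. Let $\mathrm{mult}_{ev}(\mu)$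 be the (geometric) multiplicity of $\mu$ as an eigenvalue, i.e. the dimension of the eigenspace. (1) If $J=0$ and $x_0=0$, then there are no conjugate points along $\gamma$. (2) If $J=0$ and $x_0\ne0$, then for every $t\neq 0$ the point $\gamma(t)$ is conjugate to $\gamma(0)$ along $\gamma$ if and only if $-12/t^2$ is an eigenvalue of the linear operator $A:\mathfrak z\to\mathfrak z$, $z\mapsto[x_0,J_zx_0]$, and $\mathrm{mult}_{cp}(t)=\mathrm{mult}_{ev}(-12/t^2)\le\dim\mathfrak z$, with $\mathrm{mult}_{ev}$ taken for $A$. (3) If $J\ne0$ and $x_0=0$, let $-\lambda_1^2,\dots,-\lambda_q^2$ with $\lambda_k>0$ be the distinct negative eigenvalues of $J^2$ (possibly $q=0$). Then $\gamma(t)$ is conjugate to $\gamma(0)$ along $\gamma$ if and only if $t\in\bigcup_{k=1}^q\frac{2\pi}{\lambda_k}\mathbb Z^*$, where $\mathbb Z^*=\mathbb Z\setminus\{0\}$; and for every $k$ and every $n\in\mathbb Z^*$, $$\mathrm{mult}_{cp}\Big(\frac{2\pi}{\lambda_k}n\Big)=\sum_{h\,:\,\frac{\lambda_k}{n}\mid\lambda_h}\mathrm{mult}_{ev}(-\lambda_h^2)\le\dim\mathfrak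 v ,$$ with $\mathrm{mult}_{ev}$ taken for $J^2$, where $a\mid b$ means that $b$ is a nonzero integral multiple of $a$. -/

import Mathlib

open scoped Manifold ContDiff

set_option linter.unusedSectionVars false

noncomputable section

namespace NilConj

/-! ### Inner products -/

/-- An inner product on a real vector space, of arbitrary signature: a nondegenerate symmetric
bilinear form. -/
structure PseudoInner (V : Type*) [AddCommGroup V] [Module ℝ V] where
  /-- the bilinear form -/
  form : LinearMap.BilinForm ℝ V
  symm : ∀ x y, form x y = form y x
  nondeg : form.Nondegenerate

/-! ### Metric Lie algebras -/

section Algebra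

variable {L : Type*} [LieRing L] [LieAlgebra ℝ L]

variable (L) in
/-- `L` is nilpotent of step at most two: all double brackets vanish. -/
def IsTwoStepNilpotent : Prop := ∀ x y w : L, ⁅x, ⁅y, w⁆⁆ = 0

variable (L) in
/-- The center of `L`, as a subspace. -/
abbrev centerSub : Submodule ℝ L := (LieAlgebra.center ℝ L).toSubmodule

/-- The center is nondegenerate: the inner product restricts to a nondegenerate form on it. -/
def NondegenerateCenter (B : PseudoInner L) : Prop := (B.form.restrict (centerSub L)).Nondegenerate

/-- The orthogonal complement of the center. -/
abbrev vSub (B : PseudoInner L) : Submodule ℝ L := B.form.orthogonal (centerSub L)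

theorem form_ext (B : PseudoInner L) {x y : L} (h : ∀ w, B.form x w = B.form y w) : x = y := by
  have := B.nondeg.1 (x - y) (fun w => by simp [h w])
  exact sub_eq_zero.1 this

theorem form_lie_swap (B : PseudoInner L) (x y w : L) : B.form ⁅x, y⁆ w = - B.form ⁅y, x⁆ w := by
  rw [← lie_skew, map_neg, LinearMap.neg_apply]

variable [FiniteDimensional ℝ L]

/-- The adjoint of `ad x` with respect to the inner product: `⟨ad† x u, w⟩ = ⟨u, [x, w]⟩`. -/
def adT (B : PseudoInner L) (x : L) : L →ₗ[ℝ] L :=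
  B.form.leftAdjointOfNondegenerate B.nondeg (LieAlgebra.ad ℝ L x)

theorem form_adT (B : PseudoInner L) (x u w : L) : B.form (adT B x u) w = B.form u ⁅x, w⁆ :=
  LinearMap.BilinForm.isAdjointPairLeftAdjointOfNondegenerate B.form B.nondeg
    (LieAlgebra.ad ℝ L x) u w

theorem adT_add (B : PseudoInner L) (x y u : L) : adT B (x + y) u = adT B x u + adT B y u :=
  form_ext B fun w => by simp [form_adT]

theorem adT_smul (B : PseudoInner L) (c : ℝ) (x u : L) : adT B (c • x) u = c • adT B x u :=
  form_ext B fun w => by simp [form_adT]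

theorem adT_mem_vSub (B : PseudoInner L) (x z : L) : adT B x z ∈ vSub B := by
  intro n hn
  have h : ⁅x, n⁆ = 0 := hn x
  change B.form n (adT B x z) = 0
  rw [B.symm, form_adT, h, map_zero]

/-- For `z` in the center, `J_z : 𝔳 → 𝔳` is `x ↦ ad† x z`; that is,
`⟨J_z x, y⟩ = ⟨z, [x, y]⟩`. -/
def J (B : PseudoInner L) (z : centerSub L) : Module.End ℝ (vSub B) where
  toFun x := ⟨adT B x z, adT_mem_vSub B x z⟩
  map_add' x y := Subtype.ext (adT_add B x y z)
  map_smul' c x := Subtype.ext (adT_smul B c x z)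

/-- The operator `A : 𝔷 → 𝔷`, `z ↦ [x₀, J_z x₀]`. -/
def A (B : PseudoInner L) (h2 : IsTwoStepNilpotent L) (x₀ : vSub B) :
    Module.End ℝ (centerSub L) where
  toFun z := ⟨⁅(x₀ : L), (J B z x₀ : L)⁆, fun w => h2 w _ _⟩
  map_add' z w := Subtype.ext (by simp [J])
  map_smul' c z := Subtype.ext (by simp [J])

/-- The Levi-Civita connection of the left-invariant metric, on left-invariant fields:
`∇_x y = ½ ([x, y] - ad† x y - ad† y x)`, as a linear map in `y`. It is the only operation that
satisfies the Koszul formula, see `koszul`. -/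
def nabla (B : PseudoInner L) (x : L) : L →ₗ[ℝ] L where
  toFun y := (1 / 2 : ℝ) • (⁅x, y⁆ - adT B x y - adT B y x)
  map_add' y w := by
    simp only [lie_add, map_add, adT_add, ← smul_add]
    congr 1
    abel
  map_smul' c y := by
    simp only [lie_smul, map_smul, adT_smul, ← smul_sub, RingHom.id_apply]
    rw [smul_comm]

/-- The Koszul formula for left-invariant fields. -/
theorem koszul (B : PseudoInner L) (x y w : L) :
    2 * B.form (nabla B x y) w = B.form ⁅x, y⁆ w - B.form ⁅y, w⁆ x + B.form ⁅w, x⁆ y := by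
  have h : B.form y ⁅x, w⁆ = - B.form ⁅w, x⁆ y := by
    rw [← lie_skew, map_neg, B.symm y]
  simp [nabla, form_adT, h, B.symm x]
  ring

/-- The connection has no torsion. -/
theorem nabla_sub_nabla (B : PseudoInner L) (x y : L) : nabla B x y - nabla B y x = ⁅x, y⁆ := by
  refine form_ext B fun w => ?_
  have h1 := koszul B x y w
  have h2 := koszul B y x w
  have h3 : B.form ⁅y, x⁆ w = - B.form ⁅x, y⁆ w := form_lie_swap ..
  have h4 : B.form ⁅w, x⁆ y = - B.form ⁅x, w⁆ y := form_lie_swap ..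
  have h5 : B.form ⁅w, y⁆ x = - B.form ⁅y, w⁆ x := form_lie_swap ..
  simp only [map_sub, LinearMap.sub_apply]
  linarith

/-- The connection is compatible with the metric. -/
theorem form_nabla_add (B : PseudoInner L) (x y w : L) :
    B.form (nabla B x y) w + B.form y (nabla B x w) = 0 := by
  have h1 := koszul B x y w
  have h2 := koszul B x w y
  have h3 : B.form ⁅w, y⁆ x = - B.form ⁅y, w⁆ x := form_lie_swap ..
  have h4 : B.form ⁅w, x⁆ y = - B.form ⁅x, w⁆ y := form_lie_swap ..
  have h5 : B.form ⁅y, x⁆ w = - B.form ⁅x, y⁆ w := form_lie_swap ..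
  rw [B.symm y]
  linarith

theorem nabla_add_left (B : PseudoInner L) (x y w : L) :
    nabla B (x + y) w = nabla B x w + nabla B y w := by
  simp only [nabla, LinearMap.coe_mk, AddHom.coe_mk, add_lie, map_add, adT_add, ← smul_add]
  congr 1
  abel

theorem nabla_smul_left (B : PseudoInner L) (c : ℝ) (x w : L) :
    nabla B (c • x) w = c • nabla B x w := by
  simp only [nabla, LinearMap.coe_mk, AddHom.coe_mk, smul_lie, map_smul, adT_smul, ← smul_sub]
  rw [smul_comm]

/-- The curvature tensor, on left-invariant fields:
`R(x, y) w = ∇_x ∇_y w - ∇_y ∇_x w - ∇_[x, y] w`. -/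
def curv (B : PseudoInner L) (x y w : L) : L :=
  nabla B x (nabla B y w) - nabla B y (nabla B x w) - nabla B ⁅x, y⁆ w

theorem curv_add_left (B : PseudoInner L) (x x' y w : L) :
    curv B (x + x') y w = curv B x y w + curv B x' y w := by
  simp only [curv, nabla_add_left, add_lie, map_add]
  abel

theorem curv_smul_left (B : PseudoInner L) (c : ℝ) (x y w : L) :
    curv B (c • x) y w = c • curv B x y w := by
  simp only [curv, nabla_smul_left, smul_lie, map_smul, smul_sub]

end Algebra

/-! ### Lie groups with a left-invariant metric -/

section Group

variable {E : Type*} [NormedAddCommGroup E] [NormedSpace ℝ E] [FiniteDimensional ℝ E]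
  {G : Type*} [TopologicalSpace G] [ChartedSpace E G] [Group G]

instance instFiniteDimensionalGroupLieAlgebra :
    FiniteDimensional ℝ (GroupLieAlgebra 𝓘(ℝ, E) G) :=
  inferInstanceAs (FiniteDimensional ℝ E)

instance instLieGroupMinSmoothness [h : LieGroup 𝓘(ℝ, E) ∞ G] :
    LieGroup 𝓘(ℝ, E) (minSmoothness ℝ 3) G := by
  rw [minSmoothness_of_isRCLikeNormedField]
  infer_instance

/-- The left trivialization of the tangent bundle: the differential at `g` of left translation
by `g⁻¹`, from `T_g G` to the Lie algebra `T_1 G`. -/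
def leftTriv (g : G) : TangentSpace 𝓘(ℝ, E) g →ₗ[ℝ] GroupLieAlgebra 𝓘(ℝ, E) G :=
  (mfderiv 𝓘(ℝ, E) 𝓘(ℝ, E) (fun h : G => g⁻¹ * h) g).toLinearMap

/-- The differential at `1` of left translation by `g`, from the Lie algebra to `T_g G`. -/
def leftPush (g : G) (v : GroupLieAlgebra 𝓘(ℝ, E) G) : TangentSpace 𝓘(ℝ, E) g :=
  mulInvariantVectorField v g

variable (E) in
/-- A vector field along the curve `γ`. -/
abbrev FieldAlong (γ : ℝ → G) : Type _ := (t : ℝ) → TangentSpace 𝓘(ℝ, E) (γ t)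

/-- A vector field along `γ`, moved to the Lie algebra by left translations. -/
def triv {γ : ℝ → G} (Y : FieldAlong E γ) (t : ℝ) : GroupLieAlgebra 𝓘(ℝ, E) G :=
  leftTriv (γ t) (Y t)

/-- Smooth vector fields along `γ`. Left translations identify the tangent bundle with
`G × T_1 G`, so smoothness is smoothness of the component in `T_1 G` (which is `E` as a vector
space). -/
def IsSmoothAlong {γ : ℝ → G} (Y : FieldAlong E γ) : Prop :=
  ContDiff ℝ ∞ (F := E) (triv Y)

variable (E) in
/-- The velocity field of a curve. -/
def velocity (γ : ℝ → G) : FieldAlong E γ :=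
  fun t => mfderiv 𝓘(ℝ, ℝ) 𝓘(ℝ, E) γ t (1 : ℝ)

variable [LieGroup 𝓘(ℝ, E) ∞ G]

/-- The covariant derivative of a vector field along `γ`, for the Levi-Civita connection of the
left-invariant metric. If `y = ∑ yᵢ eᵢ` and `ω` are the left-trivialized field and velocity, the
Leibniz rule for the left-invariant frame `eᵢ` gives `y' + ∇_ω y`. -/
def covDeriv (B : PseudoInner (GroupLieAlgebra 𝓘(ℝ, E) G)) {γ : ℝ → G} (Y : FieldAlong E γ) :
    FieldAlong E γ :=
  fun t => leftPush (γ t) (deriv (triv Y) t + nabla B (triv (velocity E γ) t) (triv Y t))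

/-- The curvature tensor of the left-invariant metric at `g`. -/
def curvAt (B : PseudoInner (GroupLieAlgebra 𝓘(ℝ, E) G)) (g : G)
    (u v w : TangentSpace 𝓘(ℝ, E) g) : TangentSpace 𝓘(ℝ, E) g :=
  leftPush g (curv B (leftTriv g u) (leftTriv g v) (leftTriv g w))

/-- Geodesics `γ : ℝ → G`: differentiable curves with smooth velocity and zero acceleration. -/
def IsGeodesic (B : PseudoInner (GroupLieAlgebra 𝓘(ℝ, E) G)) (γ : ℝ → G) : Prop :=
  MDifferentiable 𝓘(ℝ, ℝ) 𝓘(ℝ, E) γ ∧ IsSmoothAlong (velocity E γ) ∧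
    ∀ t, covDeriv B (velocity E γ) t = 0

/-- Jacobi fields along `γ`: smooth solutions of `∇²Y + R(Y, γ')γ' = 0`. -/
def IsJacobi (B : PseudoInner (GroupLieAlgebra 𝓘(ℝ, E) G)) {γ : ℝ → G} (Y : FieldAlong E γ) :
    Prop :=
  IsSmoothAlong Y ∧
    ∀ t, covDeriv B (covDeriv B Y) t + curvAt B (γ t) (Y t) (velocity E γ t) (velocity E γ t) = 0

theorem leftTriv_leftPush (g : G) (v : GroupLieAlgebra 𝓘(ℝ, E) G) :
    leftTriv g (leftPush g v) = v := by
  have hd : ∀ a b : G, MDifferentiableAt 𝓘(ℝ, E) 𝓘(ℝ, E) (fun h : G => a * h) b := fun a b =>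
    (contMDiff_mul_left (I := 𝓘(ℝ, E)) (n := ∞) (a := a)).contMDiffAt.mdifferentiableAt (by simp)
  have key : mfderiv 𝓘(ℝ, E) 𝓘(ℝ, E) ((fun h : G => g⁻¹ * h) ∘ (fun h : G => g * h)) 1 =
      ContinuousLinearMap.id ℝ _ := by
    have : (fun h : G => g⁻¹ * h) ∘ (fun h : G => g * h) = id := by ext x; simp
    rw [this, mfderiv_id]
  rw [mfderiv_comp (I' := 𝓘(ℝ, E)) _ (hd _ _) (hd _ _)] at key
  have h1 : ∀ (k : G) (w : E), k = g →
      (mfderiv 𝓘(ℝ, E) 𝓘(ℝ, E) (fun h : G => g⁻¹ * h) g : E → E) w =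
        (mfderiv 𝓘(ℝ, E) 𝓘(ℝ, E) (fun h : G => g⁻¹ * h) k : E → E) w := by
    rintro _ _ rfl
    rfl
  exact (h1 (g * 1) _ (mul_one g)).trans (congrArg (fun f => f v) key)

theorem triv_covDeriv (B : PseudoInner (GroupLieAlgebra 𝓘(ℝ, E) G)) {γ : ℝ → G}
    (Y : FieldAlong E γ) (t : ℝ) :
    triv (covDeriv B Y) t = deriv (triv Y) t + nabla B (triv (velocity E γ) t) (triv Y t) :=
  leftTriv_leftPush _ _

theorem IsSmoothAlong.differentiableAt {γ : ℝ → G} {Y : FieldAlong E γ} (h : IsSmoothAlong Y)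
    (t : ℝ) : DifferentiableAt ℝ (triv Y) t :=
  (ContDiff.differentiable (F := E) h (by simp)) t

theorem triv_add {γ : ℝ → G} (Y Z : FieldAlong E γ) : triv (Y + Z) = triv Y + triv Z := by
  ext t
  simp [triv]

theorem triv_smul {γ : ℝ → G} (c : ℝ) (Y : FieldAlong E γ) : triv (c • Y) = c • triv Y := by
  ext t
  simp [triv]

theorem leftPush_add (g : G) (v w : GroupLieAlgebra 𝓘(ℝ, E) G) :
    leftPush g (v + w) = leftPush g v + leftPush g w :=
  congrFun (mulInvariantVectorField_add v w) g

theorem leftPush_smul (g : G) (c : ℝ) (v : GroupLieAlgebra 𝓘(ℝ, E) G) :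
    leftPush g (c • v) = c • leftPush g v :=
  congrFun (mulInvariantVectorField_smul c v) g

theorem covDeriv_add (B : PseudoInner (GroupLieAlgebra 𝓘(ℝ, E) G)) {γ : ℝ → G}
    {Y Z : FieldAlong E γ} (hY : ∀ t, DifferentiableAt ℝ (triv Y) t)
    (hZ : ∀ t, DifferentiableAt ℝ (triv Z) t) :
    covDeriv B (Y + Z) = covDeriv B Y + covDeriv B Z := by
  funext t
  have h : deriv (triv Y + triv Z) t = deriv (triv Y) t + deriv (triv Z) t :=
    deriv_add (F := E) (hY t) (hZ t)
  simp only [covDeriv, Pi.add_apply, triv_add, h, map_add, ← leftPush_add]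
  congr 1
  abel

theorem covDeriv_smul (B : PseudoInner (GroupLieAlgebra 𝓘(ℝ, E) G)) {γ : ℝ → G} (c : ℝ)
    {Y : FieldAlong E γ} (hY : ∀ t, DifferentiableAt ℝ (triv Y) t) :
    covDeriv B (c • Y) = c • covDeriv B Y := by
  funext t
  have h : deriv (c • triv Y) t = c • deriv (triv Y) t := deriv_const_smul (F := E) c (hY t)
  simp only [covDeriv, Pi.smul_apply, triv_smul, h, map_smul, ← leftPush_smul, smul_add]

theorem differentiableAt_triv_covDeriv (B : PseudoInner (GroupLieAlgebra 𝓘(ℝ, E) G))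
    {γ : ℝ → G} {Y : FieldAlong E γ} (hγ : IsSmoothAlong (velocity E γ)) (hY : IsSmoothAlong Y)
    (t : ℝ) : DifferentiableAt ℝ (triv (covDeriv B Y)) t := by
  let N : E →ₗ[ℝ] E →ₗ[ℝ] E :=
    { toFun := nabla B
      map_add' := fun x y => LinearMap.ext fun w => nabla_add_left B x y w
      map_smul' := fun c x => LinearMap.ext fun w => nabla_smul_left B c x w }
  have h1 : DifferentiableAt ℝ (F := E) (deriv (triv Y)) t :=
    (ContDiff.differentiable (F := E)
      ((contDiff_infty_iff_deriv (F := E)).1 hY).2 (by simp)) t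
  have h2 : DifferentiableAt ℝ (F := E)
      (fun s => N.toContinuousBilinearMap (triv (velocity E γ) s) (triv Y s)) t :=
    (N.toContinuousBilinearMap.differentiableAt.comp (E := ℝ) t
      (hγ.differentiableAt t)).clm_apply (hY.differentiableAt t)
  have h3 : triv (covDeriv B Y) = fun s => (deriv (triv Y) s : E) +
      N.toContinuousBilinearMap (triv (velocity E γ) s) (triv Y s) :=
    funext fun s => triv_covDeriv B Y s
  rw [h3]
  exact h1.add h2

/-- The space of Jacobi fields along the geodesic `γ` that vanish at `γ(0)` and `γ(t)`. -/
def jacobiVanishing (B : PseudoInner (GroupLieAlgebra 𝓘(ℝ, E) G)) {γ : ℝ → G}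
    (hγ : IsGeodesic B γ) (t : ℝ) : Submodule ℝ (FieldAlong E γ) where
  carrier := {Y | IsJacobi B Y ∧ Y 0 = 0 ∧ Y t = 0}
  zero_mem' := by
    have h : triv (0 : FieldAlong E γ) = fun _ => (0 : E) := by
      ext s
      exact map_zero (leftTriv (E := E) (γ s))
    have h0 : covDeriv B (0 : FieldAlong E γ) = 0 := by
      have := covDeriv_smul B (0 : ℝ) (Y := (0 : FieldAlong E γ))
        (fun s => by rw [h]; exact differentiableAt_const (F := E) _)
      simpa using this
    refine ⟨⟨?_, fun s => ?_⟩, rfl, rfl⟩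
    · unfold IsSmoothAlong
      rw [h]
      exact contDiff_const
    · have hc := curv_smul_left B (0 : ℝ) (0 : GroupLieAlgebra 𝓘(ℝ, E) G)
        (leftTriv (γ s) (velocity E γ s)) (leftTriv (γ s) (velocity E γ s))
      have hp := leftPush_smul (γ s) (0 : ℝ) (0 : GroupLieAlgebra 𝓘(ℝ, E) G)
      simp only [zero_smul] at hc hp
      simp [h0, curvAt, hc, hp]
  add_mem' := by
    rintro Y Z ⟨⟨hY, hY'⟩, hY0, hYt⟩ ⟨⟨hZ, hZ'⟩, hZ0, hZt⟩
    refine ⟨⟨?_, fun s => ?_⟩, by simp [hY0, hZ0], by simp [hYt, hZt]⟩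
    · unfold IsSmoothAlong
      rw [triv_add]
      exact ContDiff.add (F := E) hY hZ
    · rw [covDeriv_add B hY.differentiableAt hZ.differentiableAt,
        covDeriv_add B (differentiableAt_triv_covDeriv B hγ.2.1 hY)
          (differentiableAt_triv_covDeriv B hγ.2.1 hZ)]
      have hc : curvAt B (γ s) ((Y + Z) s) (velocity E γ s) (velocity E γ s) =
          curvAt B (γ s) (Y s) (velocity E γ s) (velocity E γ s) +
            curvAt B (γ s) (Z s) (velocity E γ s) (velocity E γ s) := by
        simp only [curvAt, Pi.add_apply, map_add, curv_add_left, leftPush_add]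
      rw [hc, Pi.add_apply, add_add_add_comm, hY' s, hZ' s, add_zero]
  smul_mem' := by
    rintro c Y ⟨⟨hY, hY'⟩, hY0, hYt⟩
    refine ⟨⟨?_, fun s => ?_⟩, by simp [hY0], by simp [hYt]⟩
    · unfold IsSmoothAlong
      rw [triv_smul]
      exact ContDiff.const_smul (F := E) c hY
    · rw [covDeriv_smul B c hY.differentiableAt,
        covDeriv_smul B c (differentiableAt_triv_covDeriv B hγ.2.1 hY)]
      have hc : curvAt B (γ s) ((c • Y) s) (velocity E γ s) (velocity E γ s) =
          c • curvAt B (γ s) (Y s) (velocity E γ s) (velocity E γ s) := by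
        simp only [curvAt, Pi.smul_apply, map_smul, curv_smul_left, leftPush_smul]
      rw [hc, Pi.smul_apply, ← smul_add, hY' s, smul_zero]

/-- `γ(t)` is conjugate to `γ(0)` along `γ`: `t ≠ 0`, and some nontrivial Jacobi field along `γ`
vanishes at `0` and at `t`. -/
def IsConjugate (B : PseudoInner (GroupLieAlgebra 𝓘(ℝ, E) G)) (γ : ℝ → G) (t : ℝ) : Prop :=
  t ≠ 0 ∧ ∃ Y : FieldAlong E γ, IsJacobi B Y ∧ Y ≠ 0 ∧ Y 0 = 0 ∧ Y t = 0

/-- The multiplicity of `γ(t)` as a conjugate point: the dimension of the space of Jacobi fields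
that vanish at `0` and at `t`. -/
def multCP (B : PseudoInner (GroupLieAlgebra 𝓘(ℝ, E) G)) {γ : ℝ → G} (hγ : IsGeodesic B γ)
    (t : ℝ) : ℕ :=
  Module.finrank ℝ (jacobiVanishing B hγ t)

end Group

/-- The multiplicity of `μ` as an eigenvalue of `f`: the dimension of its eigenspace. -/
def multEV {V : Type*} [AddCommGroup V] [Module ℝ V] (f : Module.End ℝ V) (μ : ℝ) : ℕ :=
  Module.finrank ℝ (f.eigenspace μ)

/-- `a ∣ b` for reals: `b` is a nonzero integral multiple of `a`. -/
def RealDvd (a b : ℝ) : Prop := ∃ m : ℤ, m ≠ 0 ∧ b = m * a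

end NilConj

end

noncomputable section

namespace NilConj

/-! ### Spectral theorem for positive definite forms -/

/-! Left translations turn everything into ordinary differential equations in the Lie algebra. The
left-trivialized velocity `ω` of a geodesic satisfies `ω' = ad†_ω ω`. In all three cases `J x₀ = 0`,
which forces `ω = z₀ + x₀` for all time (`triv_velocity_eq`). With `η = y' + [x₀, y]`, the variation
of `ω`, the Jacobi equation for `y` is the linearized equation `η' = F η`, where `F = J + ad† x₀`
and `J` is extended by zero (`jacobi_algebra`, `isJacobi_iff`). A Jacobi field vanishing at `0` is
determined by `y'(0)`, so multiplicities are dimensions of spaces of initial velocities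
(`jacobi_multiplicity`).

If `J = 0`, then `ad x₀` and `ad† x₀` both have square zero and `y` is a cubic polynomial in time.
Its vanishing at `t` is equivalent to `ζ = v + (t/2) ad† x₀ v`, with `v = y'(0)`, being central with
`A ζ = (-12/t²) ζ` (`mem_map_eigenInit_iff`).

If `x₀ = 0`, the equation is `y'' = T y'` with `T` the extension of `J`. In indefinite signature `T`
need not be semisimple. However, solutions that return to `0` at time `t` have `t`-periodic
velocity, and averaging any Euclidean product of velocities over the period gives a positive
definite form for which `T` is skew. Hence `T²` is diagonalizable on these solutions. Its
eigenvalues are negative, and an eigenvector for `-b²` is a trigonometric solution, which returns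
exactly when `bt ∈ 2πℤ` (`range_returnInit`). -/

theorem iSup_eigenspace_eq_top_of_posDef {V : Type*} [AddCommGroup V] [Module ℝ V]
    [FiniteDimensional ℝ V] (b : LinearMap.BilinForm ℝ V) (hsymm : ∀ x y, b x y = b y x)
    (hpos : ∀ x, x ≠ 0 → 0 < b x x) (S : Module.End ℝ V) (hS : ∀ x y, b (S x) y = b x (S y)) :
    ⨆ μ, S.eigenspace μ = ⊤ := by
  let core : InnerProductSpace.Core ℝ V :=
    { inner := fun x y => b x y
      conj_inner_symm := fun x y => by simpa using hsymm y x
      re_inner_nonneg := fun x => by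
        rcases eq_or_ne x 0 with rfl | h
        · simp
        · simpa using (hpos x h).le
      add_left := fun x y z => by simp
      smul_left := fun x y r => by simp
      definite := fun x h => by
        by_contra hx
        exact (hpos x hx).ne' h }
  let _ : NormedAddCommGroup V := core.toNormedAddCommGroup
  let _ : InnerProductSpace ℝ V := InnerProductSpace.ofCore core.toCore
  have hsym : S.IsSymmetric := fun x y => hS x y
  have h := hsym.orthogonalComplement_iSup_eigenspaces_eq_bot
  rwa [Submodule.orthogonal_eq_bot_iff] at h

/-! ### Linear ordinary differential equations -/

section ODE

variable {E : Type*} [NormedAddCommGroup E] [NormedSpace ℝ E] [FiniteDimensional ℝ E]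

theorem hasDerivAt_linearMap (T : E →ₗ[ℝ] E) {f : ℝ → E} {f' : E} {s : ℝ}
    (hf : HasDerivAt f f' s) : HasDerivAt (fun r => T (f r)) (T f') s :=
  (LinearMap.toContinuousLinearMap T).hasFDerivAt.comp_hasDerivAt s hf

theorem eq_of_linear_ode (T : E →ₗ[ℝ] E) {f g : ℝ → E} (hf : ∀ s, HasDerivAt f (T (f s)) s)
    (hg : ∀ s, HasDerivAt g (T (g s)) s) (h0 : f 0 = g 0) : f = g :=
  ODE_solution_unique_univ (v := fun _ x => T x) (s := fun _ => Set.univ) (t₀ := 0)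
    (fun _ => (LinearMap.toContinuousLinearMap T).lipschitz.lipschitzOnWith)
    (fun t => ⟨hf t, trivial⟩) (fun t => ⟨hg t, trivial⟩) h0

theorem eq_zero_of_linear_ode (T : E →ₗ[ℝ] E) {f : ℝ → E} (hf : ∀ s, HasDerivAt f (T (f s)) s)
    (h0 : f 0 = 0) (s : ℝ) : f s = 0 :=
  congrFun (eq_of_linear_ode T (g := fun _ => 0) hf (fun s => by simpa using hasDerivAt_const s _)
    h0) s

theorem eq_of_hasDerivAt {f g f' : ℝ → E} (hf : ∀ s, HasDerivAt f (f' s) s)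
    (hg : ∀ s, HasDerivAt g (f' s) s) (h0 : f 0 = g 0) (s : ℝ) : f s = g s := by
  have := eq_zero_of_linear_ode (0 : E →ₗ[ℝ] E) (f := f - g)
    (fun s => by simpa using (hf s).sub (hg s)) (by simp [h0]) s
  exact sub_eq_zero.1 this

theorem hasDerivAt_of_contDiff {f : ℝ → E} (hf : ContDiff ℝ ∞ f) (s : ℝ) :
    HasDerivAt f (deriv f s) s :=
  (hf.differentiable (by simp) s).hasDerivAt

theorem contDiff_deriv {f : ℝ → E} (hf : ContDiff ℝ ∞ f) : ContDiff ℝ ∞ (deriv f) :=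
  (contDiff_infty_iff_deriv.1 hf).2

/-- The system `y' + a y = η`, `η' = F η` for `y`. -/
structure JacobiSystem (a F : E →ₗ[ℝ] E) (y : ℝ → E) : Prop where
  contDiff : ContDiff ℝ ∞ y
  hasDerivAt : ∀ s, HasDerivAt (fun r => deriv y r + a (y r)) (F (deriv y s + a (y s))) s

/-- Uniqueness in two stages: `η` vanishes by its own linear equation, and then `y' = -a y`. -/
theorem JacobiSystem.eq_zero {a F : E →ₗ[ℝ] E} {y : ℝ → E} (h : JacobiSystem a F y)
    (h0 : y 0 = 0) (h0' : deriv y 0 = 0) (s : ℝ) : y s = 0 := by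
  have h1 := eq_zero_of_linear_ode F h.hasDerivAt (by simp [h0, h0'])
  refine eq_zero_of_linear_ode (-a) (fun s => ?_) h0 s
  rw [LinearMap.neg_apply, ← eq_neg_of_add_eq_zero_left (h1 s)]
  exact hasDerivAt_of_contDiff h.contDiff s

end ODE

/-! ### The system `y' + a y = η`, `η' = d η` with `a² = d² = 0` -/

section Cubic

variable {E : Type*} [NormedAddCommGroup E] [NormedSpace ℝ E] [FiniteDimensional ℝ E]
  (a d : E →ₗ[ℝ] E)

/-- The solution of `y' + a y = η`, `η' = d η` with `y(0) = 0` and `η(0) = v`, when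
`a² = d² = 0`. -/
def cubicSol (v : E) (s : ℝ) : E :=
  s • v + (s ^ 2 / 2) • d v - (s ^ 2 / 2) • a v - (s ^ 3 / 6) • a (d v)

theorem hasDerivAt_affine (u v : E) (s : ℝ) : HasDerivAt (fun r : ℝ => u + r • v) v s := by
  simpa using ((hasDerivAt_id s).smul_const v).const_add u

theorem contDiff_cubicSol (v : E) : ContDiff ℝ ∞ (cubicSol a d v) := by
  unfold cubicSol
  fun_prop

variable {a d}

theorem hasDerivAt_cubicSol (ha : ∀ v, a (a v) = 0) (v : E) (s : ℝ) :
    HasDerivAt (cubicSol a d v) (v + s • d v - a (cubicSol a d v s)) s := by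
  have h1 : HasDerivAt (fun r : ℝ => r) 1 s := hasDerivAt_id s
  have h2 : HasDerivAt (fun r : ℝ => r ^ 2 / 2) s s := by
    refine ((h1.pow 2).div_const 2).congr_deriv ?_
    simp
  have h3 : HasDerivAt (fun r : ℝ => r ^ 3 / 6) (s ^ 2 / 2) s := by
    refine ((h1.pow 3).div_const 6).congr_deriv ?_
    simp
    ring
  have := (((h1.smul_const v).add (h2.smul_const (d v))).sub (h2.smul_const (a v))).sub
    (h3.smul_const (a (d v)))
  refine this.congr_deriv ?_
  simp only [cubicSol, map_add, map_sub, map_smul, ha, smul_zero, sub_zero, one_smul]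
  abel

/-- Since `d² = 0`, the exponential of `s d` is `1 + s d`. -/
theorem eq_affine_of_hasDerivAt (hd : ∀ v, d (d v) = 0) {η : ℝ → E}
    (hη : ∀ s, HasDerivAt η (d (η s)) s) (s : ℝ) : η s = η 0 + s • d (η 0) := by
  refine congrFun (eq_of_linear_ode d hη (g := fun s => η 0 + s • d (η 0)) (fun s => ?_)
    (by simp)) s
  refine (hasDerivAt_affine _ _ s).congr_deriv ?_
  simp [hd]

theorem eq_cubicSol (ha : ∀ v, a (a v) = 0) (hd : ∀ v, d (d v) = 0) {y η : ℝ → E}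
    (hy : ∀ s, HasDerivAt y (η s - a (y s)) s) (hη : ∀ s, HasDerivAt η (d (η s)) s)
    (h0 : y 0 = 0) (s : ℝ) : y s = cubicSol a d (η 0) s := by
  have := eq_zero_of_linear_ode (-a) (f := y - cubicSol a d (η 0)) (fun s => ?_)
    (by simp [h0, cubicSol]) s
  · exact sub_eq_zero.1 this
  · refine ((hy s).sub (hasDerivAt_cubicSol ha (η 0) s)).congr_deriv ?_
    rw [eq_affine_of_hasDerivAt hd hη s]
    simp

theorem jacobiSystem_cubicSol (ha : ∀ v, a (a v) = 0) (hd : ∀ v, d (d v) = 0) (v : E) :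
    JacobiSystem a d (cubicSol a d v) := by
  have h : ∀ s, deriv (cubicSol a d v) s + a (cubicSol a d v s) = v + s • d v := fun s => by
    rw [(hasDerivAt_cubicSol ha v s).deriv, sub_add_cancel]
  refine ⟨contDiff_cubicSol a d v, fun s => ?_⟩
  simp only [h]
  refine (hasDerivAt_affine _ _ s).congr_deriv ?_
  simp [hd]

theorem JacobiSystem.eq_cubicSol (ha : ∀ v, a (a v) = 0) (hd : ∀ v, d (d v) = 0) {y : ℝ → E}
    (h : JacobiSystem a d y) (h0 : y 0 = 0) (s : ℝ) : y s = cubicSol a d (deriv y 0) s := by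
  have := NilConj.eq_cubicSol ha hd (fun s => ?_) h.hasDerivAt h0 s
  · simpa [h0] using this
  · rw [add_sub_cancel_right]
    exact hasDerivAt_of_contDiff h.contDiff s

theorem exists_jacobiSystem_iff_cubicSol (ha : ∀ v, a (a v) = 0) (hd : ∀ v, d (d v) = 0)
    (t : ℝ) (v : E) :
    (∃ y, JacobiSystem a d y ∧ y 0 = 0 ∧ y t = 0 ∧ deriv y 0 = v) ↔ cubicSol a d v t = 0 := by
  constructor
  · rintro ⟨y, hy, hy0, hyt, rfl⟩
    rw [← hy.eq_cubicSol ha hd hy0, hyt]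
  · intro h
    refine ⟨_, jacobiSystem_cubicSol ha hd v, by simp [cubicSol], h, ?_⟩
    rw [(hasDerivAt_cubicSol ha v 0).deriv]
    simp [cubicSol]

end Cubic

/-! ### Solutions of `y'' = T y'` that return to their starting point -/

section Return

variable {E : Type*} [NormedAddCommGroup E] [NormedSpace ℝ E] [FiniteDimensional ℝ E]
  (T : E →ₗ[ℝ] E) (t : ℝ)

/-- The solutions of `y'' = T y'` that vanish at `0` and at `t`. -/
def returnSpace : Submodule ℝ (ℝ → E) where
  carrier := {y | ContDiff ℝ ∞ y ∧ (∀ s, HasDerivAt (deriv y) (T (deriv y s)) s) ∧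
    y 0 = 0 ∧ y t = 0}
  zero_mem' := by
    refine ⟨contDiff_const, fun s => ?_, rfl, rfl⟩
    have : deriv (0 : ℝ → E) = fun _ => 0 := deriv_const' 0
    rw [this]
    simpa using hasDerivAt_const s (0 : E)
  add_mem' := by
    rintro y w ⟨hy, hy', hy0, hyt⟩ ⟨hw, hw', hw0, hwt⟩
    refine ⟨hy.add hw, fun s => ?_, by simp [hy0, hw0], by simp [hyt, hwt]⟩
    have : deriv (y + w) = deriv y + deriv w := funext fun s =>
      deriv_add (hasDerivAt_of_contDiff hy s).differentiableAt
        (hasDerivAt_of_contDiff hw s).differentiableAt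
    rw [this]
    simpa using (hy' s).add (hw' s)
  smul_mem' := by
    rintro c y ⟨hy, hy', hy0, hyt⟩
    refine ⟨hy.const_smul c, fun s => ?_, by simp [hy0], by simp [hyt]⟩
    have : deriv (c • y) = c • deriv y := funext fun s =>
      deriv_const_smul c (hasDerivAt_of_contDiff hy s).differentiableAt
    rw [this]
    simpa using (hy' s).const_smul c

variable {T t}

theorem returnSpace_hasDerivAt (y : returnSpace T t) (s : ℝ) :
    HasDerivAt y.1 (deriv y.1 s) s := hasDerivAt_of_contDiff y.2.1 s

theorem deriv_apply_of_contDiff {y : ℝ → E} (hy : ContDiff ℝ ∞ y) :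
    deriv (fun s => T (y s)) = fun s => T (deriv y s) :=
  funext fun s => (hasDerivAt_linearMap T (hasDerivAt_of_contDiff hy s)).deriv

/-- A solution of `y'' = T y'` with `y(0) = 0` satisfies `y' = y'(0) + T y`. -/
theorem deriv_eq_of_mem_returnSpace (y : returnSpace T t) (s : ℝ) :
    deriv y.1 s = deriv y.1 0 + T (y.1 s) := by
  refine eq_of_hasDerivAt y.2.2.1
    (fun s => (hasDerivAt_linearMap T (returnSpace_hasDerivAt y s)).const_add (deriv y.1 0)) ?_ s
  simp [y.2.2.2.1]

/-- The first integral `y' - T y` takes equal values at `0` and `t`, where `y` vanishes. This is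
what makes the boundary terms in the averaging argument cancel. -/
theorem returnSpace_periodic (y : returnSpace T t) : deriv y.1 t = deriv y.1 0 := by
  rw [deriv_eq_of_mem_returnSpace y t, y.2.2.2.2, map_zero, add_zero]

variable (T t)

/-- The initial velocity of a solution. -/
def returnInit : returnSpace T t →ₗ[ℝ] E where
  toFun y := deriv y.1 0
  map_add' y w := deriv_add (returnSpace_hasDerivAt y 0).differentiableAt
    (returnSpace_hasDerivAt w 0).differentiableAt
  map_smul' c y := deriv_const_smul c (returnSpace_hasDerivAt y 0).differentiableAt

theorem returnInit_injective : Function.Injective (returnInit T t) := by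
  rw [injective_iff_map_eq_zero]
  intro y hy
  have h1 : ∀ s, deriv y.1 s = 0 := eq_zero_of_linear_ode T y.2.2.1 hy
  refine Subtype.ext (funext fun s => ?_)
  exact eq_of_hasDerivAt (g := fun _ => 0) (returnSpace_hasDerivAt y)
    (fun s => by rw [h1]; exact hasDerivAt_const s _) y.2.2.2.1 s

instance : FiniteDimensional ℝ (returnSpace T t) :=
  FiniteDimensional.of_injective _ (returnInit_injective T t)

/-- Composition with `T`, on the space of solutions. -/
def returnOp : Module.End ℝ (returnSpace T t) where
  toFun y := ⟨fun s => T (y.1 s), by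
    refine ⟨(LinearMap.toContinuousLinearMap T).contDiff.comp y.2.1, fun s => ?_, ?_, ?_⟩
    · rw [deriv_apply_of_contDiff y.2.1]
      exact hasDerivAt_linearMap T (y.2.2.1 s)
    · simp [y.2.2.2.1]
    · simp [y.2.2.2.2]⟩
  map_add' y w := Subtype.ext (funext fun s => by simp)
  map_smul' c y := Subtype.ext (funext fun s => by simp)

theorem deriv_returnOp (y : returnSpace T t) (s : ℝ) :
    deriv (returnOp T t y).1 s = T (deriv y.1 s) :=
  congrFun (deriv_apply_of_contDiff y.2.1) s

/-- An inner product on `E`. -/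
def auxInner (u v : E) : ℝ := inner ℝ (toEuclidean u) (toEuclidean v)

theorem continuous_auxInner {f g : ℝ → E} (hf : Continuous f) (hg : Continuous g) :
    Continuous fun s => auxInner (f s) (g s) :=
  (toEuclidean.continuous.comp hf).inner (toEuclidean.continuous.comp hg)

theorem hasDerivAt_auxInner {f g : ℝ → E} {f' g' : E} {s : ℝ} (hf : HasDerivAt f f' s)
    (hg : HasDerivAt g g' s) :
    HasDerivAt (fun s => auxInner (f s) (g s)) (auxInner (f s) g' + auxInner f' (g s)) s :=
  HasDerivAt.inner ℝ
    ((toEuclidean (E := E)).toContinuousLinearMap.hasFDerivAt.comp_hasDerivAt s hf)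
    ((toEuclidean (E := E)).toContinuousLinearMap.hasFDerivAt.comp_hasDerivAt s hg)

theorem continuous_velocity (y : returnSpace T t) : Continuous fun s : ℝ => deriv y.1 (t * s) :=
  (contDiff_deriv y.2.1).continuous.comp (continuous_const.mul continuous_id)

theorem intervalIntegrable_returnForm (y w : returnSpace T t) :
    IntervalIntegrable (fun s : ℝ => auxInner (deriv y.1 (t * s)) (deriv w.1 (t * s)))
      MeasureTheory.volume 0 1 :=
  (continuous_auxInner (continuous_velocity T t y) (continuous_velocity T t w)).intervalIntegrable
    _ _

theorem auxInner_comm (u v : E) : auxInner u v = auxInner v u := real_inner_comm _ _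

/-- The average over the period of the inner product of the velocities. -/
def returnForm : LinearMap.BilinForm ℝ (returnSpace T t) :=
  LinearMap.mk₂ ℝ
    (fun y w => ∫ s in (0 : ℝ)..1, auxInner (deriv y.1 (t * s)) (deriv w.1 (t * s)))
    (fun y y' w => by
      rw [← intervalIntegral.integral_add (intervalIntegrable_returnForm T t y w)
        (intervalIntegrable_returnForm T t y' w)]
      congr 1
      funext s
      have : deriv (y + y').1 (t * s) = deriv y.1 (t * s) + deriv y'.1 (t * s) :=
        deriv_add (returnSpace_hasDerivAt y _).differentiableAt
          (returnSpace_hasDerivAt y' _).differentiableAt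
      simp only [this, auxInner, map_add, inner_add_left])
    (fun c y w => by
      rw [smul_eq_mul, ← intervalIntegral.integral_const_mul]
      congr 1
      funext s
      have : deriv (c • y).1 (t * s) = c • deriv y.1 (t * s) :=
        deriv_const_smul c (returnSpace_hasDerivAt y _).differentiableAt
      simp only [this, auxInner, map_smul, inner_smul_left, conj_trivial])
    (fun y w w' => by
      rw [← intervalIntegral.integral_add (intervalIntegrable_returnForm T t y w)
        (intervalIntegrable_returnForm T t y w')]
      congr 1
      funext s
      have : deriv (w + w').1 (t * s) = deriv w.1 (t * s) + deriv w'.1 (t * s) :=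
        deriv_add (returnSpace_hasDerivAt w _).differentiableAt
          (returnSpace_hasDerivAt w' _).differentiableAt
      simp only [this, auxInner, map_add, inner_add_right])
    (fun c y w => by
      rw [smul_eq_mul, ← intervalIntegral.integral_const_mul]
      congr 1
      funext s
      have : deriv (c • w).1 (t * s) = c • deriv w.1 (t * s) :=
        deriv_const_smul c (returnSpace_hasDerivAt w _).differentiableAt
      simp only [this, auxInner, map_smul, inner_smul_right])

theorem returnForm_apply (y w : returnSpace T t) : returnForm T t y w =
    ∫ s in (0 : ℝ)..1, auxInner (deriv y.1 (t * s)) (deriv w.1 (t * s)) := rfl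

theorem returnForm_symm (y w : returnSpace T t) : returnForm T t y w = returnForm T t w y := by
  simp only [returnForm_apply, auxInner_comm]

theorem returnForm_pos (y : returnSpace T t) (hy : y ≠ 0) : 0 < returnForm T t y y := by
  rw [returnForm_apply]
  have hv : deriv y.1 0 ≠ 0 := fun h =>
    hy (returnInit_injective T t (h.trans (map_zero (returnInit T t)).symm))
  refine intervalIntegral.integral_pos one_pos
    (continuous_auxInner (continuous_velocity T t y) (continuous_velocity T t y)).continuousOn
    (fun s _ => real_inner_self_nonneg) ⟨0, by simp, ?_⟩
  simpa [auxInner] using real_inner_self_pos.2 ((toEuclidean (E := E)).map_ne_zero_iff.2 hv)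

variable {t}

/-- The sum of the two integrands is a derivative, because `y'' = T y'` and `w'' = T w'`; its
integral over one period is zero. The operator `T` itself need not be skew for `auxInner`. -/
theorem returnForm_skew (ht : t ≠ 0) (y w : returnSpace T t) :
    returnForm T t (returnOp T t y) w = - returnForm T t y (returnOp T t w) := by
  rw [eq_neg_iff_add_eq_zero, returnForm_apply, returnForm_apply,
    ← intervalIntegral.integral_add (intervalIntegrable_returnForm T t _ w)
        (intervalIntegrable_returnForm T t y _)]
  -- The factor `t⁻¹` cancels the `t` that the chain rule produces from rescaling the period to `[0,
  -- 1]`.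
  have hd : ∀ s : ℝ, HasDerivAt
      (fun s : ℝ => t⁻¹ * auxInner (deriv y.1 (t * s)) (deriv w.1 (t * s)))
      (auxInner (deriv (returnOp T t y).1 (t * s)) (deriv w.1 (t * s)) +
        auxInner (deriv y.1 (t * s)) (deriv (returnOp T t w).1 (t * s))) s := by
    intro s
    have hm : HasDerivAt (fun s : ℝ => t * s) t s := by simpa using (hasDerivAt_id s).const_mul t
    have h1 := (y.2.2.1 (t * s)).scomp s hm
    have h2 := (w.2.2.1 (t * s)).scomp s hm
    refine ((hasDerivAt_auxInner h1 h2).const_mul t⁻¹).congr_deriv ?_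
    simp only [deriv_returnOp, auxInner, map_smul, inner_smul_left, inner_smul_right,
      Function.comp_apply, conj_trivial]
    field_simp
    ring
  rw [intervalIntegral.integral_eq_sub_of_hasDerivAt (fun s _ => hd s)
    ((intervalIntegrable_returnForm T t _ w).add (intervalIntegrable_returnForm T t y _))]
  simp [returnSpace_periodic]

/-- The square of a skew operator is self-adjoint, and the averaged form is positive definite. -/
theorem iSup_eigenspace_returnOp_sq (ht : t ≠ 0) :
    ⨆ μ, (returnOp T t ^ 2).eigenspace μ = ⊤ := by
  refine iSup_eigenspace_eq_top_of_posDef (returnForm T t) (returnForm_symm T t)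
    (returnForm_pos T t) _ fun y w => ?_
  simp only [sq, Module.End.mul_apply, returnForm_skew T ht, neg_neg]

/-- The solution of `y'' = T y'` with `y(0) = 0` and `y'(0) = v`, when `T² v = -b² v`. -/
def trigSol (b : ℝ) (v : E) (s : ℝ) : E :=
  (Real.sin (b * s) / b) • v + ((1 - Real.cos (b * s)) / b ^ 2) • T v

theorem contDiff_trigSol (b : ℝ) (v : E) : ContDiff ℝ ∞ (trigSol T b v) := by
  unfold trigSol
  refine ContDiff.add ?_ ?_
  · exact ((Real.contDiff_sin.comp (contDiff_const.mul contDiff_id)).div_const b).smul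
      contDiff_const
  · exact ((contDiff_const.sub (Real.contDiff_cos.comp
      (contDiff_const.mul contDiff_id))).div_const _).smul contDiff_const

variable {T}

theorem hasDerivAt_trigSol {b : ℝ} (hb : b ≠ 0) {v : E} (s : ℝ) :
    HasDerivAt (trigSol T b v) (Real.cos (b * s) • v + (Real.sin (b * s) / b) • T v) s := by
  have hm : HasDerivAt (fun s : ℝ => b * s) b s := by simpa using (hasDerivAt_id s).const_mul b
  have h1 := (hm.sin.div_const b).smul_const v
  have h2 := ((hm.cos.const_sub 1).div_const (b ^ 2)).smul_const (T v)
  refine (h1.add h2).congr_deriv ?_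
  congr 2 <;> field_simp

theorem hasDerivAt_deriv_trigSol {b : ℝ} (hb : b ≠ 0) {v : E} (hv : T (T v) = (-b ^ 2) • v)
    (s : ℝ) : HasDerivAt (deriv (trigSol T b v)) (T (deriv (trigSol T b v) s)) s := by
  have he : deriv (trigSol T b v) =
      fun s => Real.cos (b * s) • v + (Real.sin (b * s) / b) • T v :=
    funext fun s => (hasDerivAt_trigSol hb s).deriv
  have hm : HasDerivAt (fun s : ℝ => b * s) b s := by simpa using (hasDerivAt_id s).const_mul b
  rw [he]
  refine ((hm.cos.smul_const v).add ((hm.sin.div_const b).smul_const (T v))).congr_deriv ?_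
  simp only [map_add, map_smul, hv, smul_smul]
  rw [add_comm]
  congr 2 <;> field_simp

theorem eq_trigSol {b : ℝ} (hb : b ≠ 0) (y : returnSpace T t)
    (hv : T (T (deriv y.1 0)) = (-b ^ 2) • deriv y.1 0) : y.1 = trigSol T b (deriv y.1 0) := by
  have h0 : deriv (trigSol T b (deriv y.1 0)) 0 = deriv y.1 0 := by
    rw [(hasDerivAt_trigSol hb 0).deriv]
    simp
  have h1 := eq_of_linear_ode T y.2.2.1 (hasDerivAt_deriv_trigSol hb hv) h0.symm
  funext s
  refine eq_of_hasDerivAt (returnSpace_hasDerivAt y) (fun s => ?_) ?_ s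
  · have := hasDerivAt_of_contDiff (contDiff_trigSol T b (deriv y.1 0)) s
    rwa [← h1] at this
  · simp [y.2.2.2.1, trigSol]

/-- Applying `T` to `p v + r T v = 0` and eliminating `T v` gives `(p² + r² b²) v = 0`, so both
coefficients vanish. For the converse, `cos = 1` already forces `sin = 0`. -/
theorem trigSol_eq_zero_iff {b : ℝ} (hb : 0 < b) {v : E} (hv : T (T v) = (-b ^ 2) • v)
    (hv0 : v ≠ 0) : trigSol T b v t = 0 ↔ ∃ m : ℤ, b * t = 2 * Real.pi * m := by
  constructor
  · intro h
    set p := Real.sin (b * t) / b with hp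
    set r := (1 - Real.cos (b * t)) / b ^ 2 with hr
    have h1 : p • v + r • T v = 0 := h
    have h2 : p • T v + r • (-b ^ 2) • v = 0 := by
      have := congrArg T h1
      simpa only [map_add, map_smul, hv, map_zero] using this
    have h3 : (p ^ 2 + r ^ 2 * b ^ 2) • v = 0 := by
      have e : (p ^ 2 + r ^ 2 * b ^ 2) • v =
          p • (p • v + r • T v) - r • (p • T v + r • (-b ^ 2) • v) := by module
      rw [e, h1, h2]
      simp
    have h4 : p ^ 2 + r ^ 2 * b ^ 2 = 0 := (smul_eq_zero.1 h3).resolve_right hv0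
    have h5 : r = 0 := by
      have : r ^ 2 * b ^ 2 = 0 := by nlinarith [sq_nonneg p, sq_nonneg (r * b)]
      simpa [hb.ne'] using this
    have h6 : Real.cos (b * t) = 1 := by
      rw [hr, div_eq_zero_iff] at h5
      have := h5.resolve_right (by positivity)
      linarith
    obtain ⟨m, hm⟩ := (Real.cos_eq_one_iff _).1 h6
    exact ⟨m, by rw [← hm]; ring⟩
  · rintro ⟨m, hm⟩
    have h1 : Real.cos (b * t) = 1 := (Real.cos_eq_one_iff _).2 ⟨m, by rw [hm]; ring⟩
    have h2 : Real.sin (b * t) = 0 := by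
      have := Real.sin_sq_add_cos_sq (b * t)
      rw [h1] at this
      nlinarith
    simp [trigSol, h1, h2]

theorem eigenspace_le_range_returnInit {b : ℝ} (hb : 0 < b) (m : ℤ)
    (hm : b * t = 2 * Real.pi * m) :
    (T ^ 2 : Module.End ℝ E).eigenspace (-b ^ 2) ≤ LinearMap.range (returnInit T t) := by
  intro v hv
  rw [Module.End.mem_eigenspace_iff, sq, Module.End.mul_apply] at hv
  rcases eq_or_ne v 0 with rfl | hv0
  · exact zero_mem _
  refine ⟨⟨trigSol T b v, contDiff_trigSol T b v, hasDerivAt_deriv_trigSol hb.ne' hv,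
    by simp [trigSol], (trigSol_eq_zero_iff hb hv hv0).2 ⟨m, hm⟩⟩, ?_⟩
  change deriv (trigSol T b v) 0 = v
  rw [(hasDerivAt_trigSol hb.ne' 0).deriv]
  simp

/-- By skewness `μ ⟨y, y⟩ = -⟨T y, T y⟩`, so `μ < 0` once `T y ≠ 0`. Then `y` is a trigonometric
solution of frequency `b = √(-μ)`, and its vanishing at `t` gives the resonance condition. -/
theorem map_returnInit_eigenspace (ht : t ≠ 0) (μ : ℝ) (y : returnSpace T t)
    (hy : y ∈ (returnOp T t ^ 2).eigenspace μ) (hy0 : y ≠ 0) :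
    ∃ b : ℝ, 0 < b ∧ (∃ m : ℤ, b * t = 2 * Real.pi * m) ∧
      returnInit T t y ∈ (T ^ 2 : Module.End ℝ E).eigenspace (-b ^ 2) := by
  rw [Module.End.mem_eigenspace_iff, sq, Module.End.mul_apply] at hy
  have hv : T (T (deriv y.1 0)) = μ • deriv y.1 0 := by
    have := congrArg (returnInit T t) hy
    rw [map_smul] at this
    simpa only [returnInit, LinearMap.coe_mk, AddHom.coe_mk, deriv_returnOp] using this
  have hv0 : deriv y.1 0 ≠ 0 := fun h =>
    hy0 (returnInit_injective T t (h.trans (map_zero (returnInit T t)).symm))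
  have hyy := returnForm_pos T t y hy0
  have hμ : μ * returnForm T t y y =
      - returnForm T t (returnOp T t y) (returnOp T t y) := by
    rw [← returnForm_skew T ht, hy, map_smul, LinearMap.smul_apply, smul_eq_mul]
  -- If `T y = 0`, the velocity is constant, and a nonzero linear motion does not return.
  have hop : returnOp T t y ≠ 0 := by
    intro h
    have h1 : ∀ s, T (y.1 s) = 0 := fun s => congrFun (congrArg Subtype.val h) s
    have h2 : ∀ s, y.1 s = s • deriv y.1 0 := by
      refine eq_of_hasDerivAt (returnSpace_hasDerivAt y) (fun s => ?_) (by simp [y.2.2.2.1])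
      rw [deriv_eq_of_mem_returnSpace y s, h1, add_zero]
      simpa using (hasDerivAt_id s).smul_const (deriv y.1 0)
    have h3 := h2 t
    rw [y.2.2.2.2] at h3
    exact hv0 ((smul_eq_zero.1 h3.symm).resolve_left ht)
  have hop' := returnForm_pos T t _ hop
  have hneg : μ < 0 := by
    by_contra h
    nlinarith [mul_nonneg (not_lt.1 h) hyy.le]
  have hb : 0 < √(-μ) := Real.sqrt_pos.2 (by linarith)
  have hb2 : -√(-μ) ^ 2 = μ := by rw [Real.sq_sqrt (by linarith)]; ring
  rw [← hb2] at hv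
  refine ⟨√(-μ), hb, (trigSol_eq_zero_iff hb hv hv0).1 ?_, ?_⟩
  · rw [← eq_trigSol hb.ne' y hv, y.2.2.2.2]
  · rw [Module.End.mem_eigenspace_iff, sq, Module.End.mul_apply]
    exact hv

theorem range_returnInit (ht : t ≠ 0) : LinearMap.range (returnInit T t) =
    ⨆ b : {b : ℝ // 0 < b ∧ ∃ m : ℤ, b * t = 2 * Real.pi * m},
      (T ^ 2 : Module.End ℝ E).eigenspace (-b.1 ^ 2) := by
  apply le_antisymm
  · rw [LinearMap.range_eq_map, ← iSup_eigenspace_returnOp_sq T ht, Submodule.map_iSup]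
    refine iSup_le fun μ => ?_
    rintro _ ⟨y, hy, rfl⟩
    rcases eq_or_ne y 0 with rfl | hy0
    · rw [map_zero]
      exact zero_mem _
    obtain ⟨b, hb, hm, h⟩ := map_returnInit_eigenspace ht μ y hy hy0
    exact Submodule.mem_iSup_of_mem
      (⟨b, hb, hm⟩ : {b : ℝ // 0 < b ∧ ∃ m : ℤ, b * t = 2 * Real.pi * m}) h
  · exact iSup_le fun b => eigenspace_le_range_returnInit b.2.1 _ b.2.2.choose_spec

variable (T t)

theorem exists_jacobiSystem_iff_mem_range (v : E) :
    (∃ y, JacobiSystem 0 T y ∧ y 0 = 0 ∧ y t = 0 ∧ deriv y 0 = v) ↔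
      v ∈ LinearMap.range (returnInit T t) := by
  constructor
  · rintro ⟨y, hy, hy0, hyt, rfl⟩
    exact ⟨⟨y, hy.contDiff, by simpa using hy.hasDerivAt, hy0, hyt⟩, rfl⟩
  · rintro ⟨y, rfl⟩
    exact ⟨y.1, ⟨y.2.1, by simpa using y.2.2.1⟩, y.2.2.2.1, y.2.2.2.2, rfl⟩

variable {T t}

/-- A resonant frequency `b` either has a trivial eigenspace or equals some `lam k`, positivity
fixing the sign of the square root. -/
theorem range_returnInit_eq_biSup (ht : t ≠ 0) {ι : Type*} (lam : ι → ℝ) (hpos : ∀ k, 0 < lam k)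
    (hlam : ∀ μ : ℝ, (μ < 0 ∧ (T ^ 2 : Module.End ℝ E).HasEigenvalue μ) ↔ ∃ k, μ = -lam k ^ 2)
    (s : Finset ι) (hs : ∀ k, k ∈ s ↔ ∃ m : ℤ, lam k * t = 2 * Real.pi * m) :
    LinearMap.range (returnInit T t) =
      ⨆ k ∈ s, (T ^ 2 : Module.End ℝ E).eigenspace (-lam k ^ 2) := by
  rw [range_returnInit ht]
  apply le_antisymm
  · refine iSup_le fun ⟨b, hb, hm⟩ => ?_
    by_cases h : (T ^ 2 : Module.End ℝ E).eigenspace (-b ^ 2) = ⊥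
    · simp only [h, bot_le]
    · obtain ⟨k, hk⟩ := (hlam (-b ^ 2)).1 ⟨by nlinarith, h⟩
      have hbk : b = lam k := by
        have := hpos k
        nlinarith
      subst hbk
      exact le_iSup₂_of_le k ((hs k).2 hm) le_rfl
  · exact iSup₂_le fun k hk => le_iSup_of_le
      (⟨lam k, hpos k, (hs k).1 hk⟩ : {b : ℝ // 0 < b ∧ ∃ m : ℤ, b * t = 2 * Real.pi * m}) le_rfl

end Return

/-- Eigenspaces of distinct eigenvalues are independent, so dimensions add. -/
theorem finrank_biSup_eigenspace {V : Type*} [AddCommGroup V] [Module ℝ V]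
    [FiniteDimensional ℝ V] (f : Module.End ℝ V) {ι : Type*} {μ : ι → ℝ}
    (hμ : Function.Injective μ) (s : Finset ι) :
    Module.finrank ℝ (⨆ i ∈ s, f.eigenspace (μ i) : Submodule ℝ V) = ∑ i ∈ s, multEV f (μ i) := by
  classical
  have hind : iSupIndep fun i => f.eigenspace (μ i) := f.eigenspaces_iSupIndep.comp hμ
  induction s using Finset.induction_on with
  | empty => simp
  | insert i s hi ih =>
    have hdis : Disjoint (f.eigenspace (μ i)) (⨆ j ∈ s, f.eigenspace (μ j)) :=
      hind.disjoint_biSup (y := (s : Set ι)) hi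
    have := Submodule.finrank_sup_add_finrank_inf_eq (f.eigenspace (μ i))
      (⨆ j ∈ s, f.eigenspace (μ j))
    rw [hdis.eq_bot, finrank_bot, add_zero, ih] at this
    rw [Finset.iSup_insert, Finset.sum_insert hi, this, multEV]

/-! ### The algebra of `ad†` -/

section MetricLie

variable {L : Type*} [LieRing L] [LieAlgebra ℝ L] [FiniteDimensional ℝ L] {B : PseudoInner L}

theorem lie_mem_centerSub (h2 : IsTwoStepNilpotent L) (x y : L) : ⁅x, y⁆ ∈ centerSub L :=
  fun w => h2 w x y

theorem form_eq_zero_of_mem {n u : L} (hn : n ∈ centerSub L) (hu : u ∈ vSub B) :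
    B.form u n = 0 := by
  rw [B.symm]
  exact hu n hn

theorem adT_center {x : L} (hx : x ∈ centerSub L) (u : L) : adT B x u = 0 :=
  form_ext B fun w => by
    have h : ⁅x, w⁆ = 0 := by
      rw [← lie_skew, hx w, neg_zero]
    rw [form_adT, h]
    simp

theorem adT_vSub (h2 : IsTwoStepNilpotent L) (x : L) {u : L} (hu : u ∈ vSub B) :
    adT B x u = 0 :=
  form_ext B fun w => by
    rw [form_adT, form_eq_zero_of_mem (lie_mem_centerSub h2 x w) hu]
    simp

variable (B) in
/-- The map `x ↦ ad† x z` on all of `L`. For central `z` it extends `J_z` by zero. -/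
def jExt (z : L) : L →ₗ[ℝ] L where
  toFun x := adT B x z
  map_add' x y := adT_add B x y z
  map_smul' c x := by
    refine form_ext B fun w => ?_
    simp [form_adT]

theorem jExt_apply (z x : L) : jExt B z x = adT B x z := rfl

theorem jExt_mem_vSub (z x : L) : jExt B z x ∈ vSub B := adT_mem_vSub B x z

/-- Nondegeneracy of the center gives `𝔫 = 𝔷 ⊕ 𝔳`, and `jExt` always kills `𝔷`. -/
theorem jExt_eq_zero_of_J (hz : NondegenerateCenter B) {z : centerSub L} (hJ : J B z = 0) :
    jExt B (z : L) = 0 := by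
  have hc : IsCompl (centerSub L) (vSub B) :=
    LinearMap.BilinForm.isCompl_orthogonal_of_restrict_nondegenerate
      (fun x y h => by rw [B.symm]; exact h) hz
  ext x
  obtain ⟨u, hu, v, hv, rfl⟩ := Submodule.mem_sup.1 (hc.sup_eq_top ▸ Submodule.mem_top (x := x))
  have h1 : jExt B (z : L) v = 0 := by
    have := congrArg Subtype.val (LinearMap.congr_fun hJ ⟨v, hv⟩)
    exact this
  rw [map_add, h1, jExt_apply, adT_center hu]
  simp

/-- An eigenvector for a nonzero eigenvalue lies in the image of `jExt`, hence in `𝔳`. -/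
theorem map_eigenspace_J_sq (z : centerSub L) {μ : ℝ} (hμ : μ ≠ 0) :
    ((J B z ^ 2).eigenspace μ).map (vSub B).subtype =
      (jExt B (z : L) ^ 2 : Module.End ℝ L).eigenspace μ := by
  ext x
  simp only [Submodule.mem_map, Module.End.mem_eigenspace_iff, sq, Module.End.mul_apply]
  constructor
  · rintro ⟨v, hv, rfl⟩
    exact congrArg Subtype.val hv
  · intro hx
    have hm : x ∈ vSub B := by
      have : x = μ⁻¹ • jExt B (z : L) (jExt B (z : L) x) := by
        rw [hx, smul_smul, inv_mul_cancel₀ hμ, one_smul]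
      rw [this]
      exact Submodule.smul_mem _ _ (jExt_mem_vSub _ _)
    exact ⟨⟨x, hm⟩, Subtype.ext hx, rfl⟩

theorem multEV_J_sq (z : centerSub L) {μ : ℝ} (hμ : μ ≠ 0) :
    multEV (J B z ^ 2) μ = multEV (jExt B (z : L) ^ 2 : Module.End ℝ L) μ := by
  rw [multEV, multEV, ← map_eigenspace_J_sq z hμ, Submodule.finrank_map_subtype_eq]

theorem hasEigenvalue_J_sq_iff (z : centerSub L) {μ : ℝ} (hμ : μ ≠ 0) :
    (J B z ^ 2).HasEigenvalue μ ↔ (jExt B (z : L) ^ 2 : Module.End ℝ L).HasEigenvalue μ := by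
  rw [Module.End.hasEigenvalue_iff, Module.End.hasEigenvalue_iff, ← map_eigenspace_J_sq z hμ, ne_eq,
    ne_eq, (Submodule.map_injective_of_injective (Submodule.subtype_injective _)).eq_iff'
      (Submodule.map_bot _)]

theorem nabla_self (x : L) : nabla B x x = - adT B x x := by
  simp only [nabla, LinearMap.coe_mk, AddHom.coe_mk, lie_self]
  module

theorem nabla_add_nabla (x y : L) : nabla B x y + nabla B y x = -(adT B x y + adT B y x) := by
  simp only [nabla, LinearMap.coe_mk, AddHom.coe_mk, ← lie_skew x y]
  module

/-- As `∇_w w = 0`, torsion-freeness reduces the left side to `∇_η w + ∇_w η` with `η = y' + [w,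
y]`. The right side is minus the linearization at `w` of `ω ↦ ad†_ω ω` in the direction `η`. -/
theorem jacobi_identity_nabla {w : L} (hw : adT B w w = 0) (y y' : L) :
    nabla B y' w + nabla B w (y' + nabla B w y) + curv B y w w =
      -(adT B (y' + ⁅w, y⁆) w + adT B w (y' + ⁅w, y⁆)) := by
  have h0 : nabla B w w = 0 := by rw [nabla_self, hw, neg_zero]
  have h1 : nabla B w y = ⁅w, y⁆ + nabla B y w := by
    rw [← nabla_sub_nabla B w y]
    abel
  have h2 : nabla B ⁅y, w⁆ w = - nabla B ⁅w, y⁆ w := by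
    rw [← lie_skew, ← neg_one_smul ℝ, nabla_smul_left, neg_one_smul]
  rw [← nabla_add_nabla, curv, h0, h2, h1, nabla_add_left]
  simp only [map_add, map_zero]
  abel

/-- With a constant central part `z`, this makes the geodesic equation linear. -/
theorem adT_self_of_decomp (h2 : IsTwoStepNilpotent L) {z x w : L} (hx : x ∈ vSub B)
    (hw : w = z + x) : adT B w w = jExt B z w := by
  conv_lhs => rw [hw, map_add, adT_vSub h2 _ hx, add_zero, ← hw]
  rfl

theorem adT_linearization (h2 : IsTwoStepNilpotent L) {z x : L} (hz : z ∈ centerSub L)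
    (hx : x ∈ vSub B) (u : L) :
    adT B u (z + x) + adT B (z + x) u = (jExt B z + adT B x) u := by
  rw [map_add, adT_vSub h2 _ hx, adT_add, adT_center hz]
  simp [jExt_apply]

/-- The Jacobi operator becomes `η' - F η` for `η = y' + [x, y]` and `F = jExt B z + adT B x`; the
hypothesis `hJ` makes `z + x` a stationary velocity. -/
theorem jacobi_algebra (h2 : IsTwoStepNilpotent L) {z x : L} (hz : z ∈ centerSub L)
    (hx : x ∈ vSub B) (hJ : jExt B z x = 0) (y y' y'' : L) :
    y'' + nabla B (z + x) y' + nabla B (z + x) (y' + nabla B (z + x) y) +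
        curv B y (z + x) (z + x) =
      y'' + ⁅x, y'⁆ - (jExt B z + adT B x) (y' + ⁅x, y⁆) := by
  have hww : adT B (z + x) (z + x) = 0 := by
    rw [adT_self_of_decomp h2 hx rfl, map_add, hJ, jExt_apply, adT_center hz, add_zero]
  have hlie : ∀ u : L, ⁅z + x, u⁆ = ⁅x, u⁆ := by
    intro u
    rw [add_lie, ← lie_skew z u, hz u, neg_zero, zero_add]
  have h1 : nabla B (z + x) y' = ⁅x, y'⁆ + nabla B y' (z + x) := by
    rw [← hlie, ← nabla_sub_nabla B (z + x) y']
    abel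
  have h3 := jacobi_identity_nabla hww y y'
  rw [hlie, adT_linearization h2 hz hx] at h3
  rw [sub_eq_add_neg, ← h3]
  nth_rw 1 [h1]
  abel

theorem adT_adT (h2 : IsTwoStepNilpotent L) (x u : L) : adT B x (adT B x u) = 0 :=
  adT_vSub h2 x (adT_mem_vSub B x u)

variable (B) in
/-- The initial velocity, in the left trivialization, of the Jacobi field that vanishes at `0` and
`t` and corresponds to the eigenvector `z` of `A`. -/
def eigenInit (x : L) (t : ℝ) : centerSub L →ₗ[ℝ] L :=
  (LinearMap.id - (t / 2) • adT B x) ∘ₗ (centerSub L).subtype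

theorem eigenInit_apply (x : L) (t : ℝ) (ζ : centerSub L) :
    eigenInit B x t ζ = (ζ : L) - (t / 2) • adT B x ζ := rfl

theorem eigenInit_injective (h2 : IsTwoStepNilpotent L) (x : L) (t : ℝ) :
    Function.Injective (eigenInit B x t) := by
  rw [injective_iff_map_eq_zero]
  intro ζ h
  rw [eigenInit_apply] at h
  have h1 := congrArg (adT B x) h
  rw [map_sub, map_smul, adT_adT h2, smul_zero, sub_zero, map_zero] at h1
  rw [h1, smul_zero, sub_zero] at h
  exact Subtype.ext h

theorem finrank_map_eigenInit (h2 : IsTwoStepNilpotent L) (x : L) (t : ℝ)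
    (p : Submodule ℝ (centerSub L)) :
    Module.finrank ℝ (p.map (eigenInit B x t)) = Module.finrank ℝ p :=
  (Submodule.equivMapOfInjective _ (eigenInit_injective h2 x t) p).finrank_eq.symm

theorem map_eigenInit_eq_bot_iff (h2 : IsTwoStepNilpotent L) (x : L) (t : ℝ)
    (p : Submodule ℝ (centerSub L)) : p.map (eigenInit B x t) = ⊥ ↔ p = ⊥ :=
  (Submodule.map_injective_of_injective (eigenInit_injective h2 x t)).eq_iff' (Submodule.map_bot _)

/-- The right side is the vanishing at `t` of the cubic solution with initial velocity `v`. The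
inverse of `eigenInit` on such `v` is `v ↦ v + (t/2) D v`, because `D² = 0`. -/
theorem mem_map_eigenInit_iff (h2 : IsTwoStepNilpotent L) (x₀ : vSub B) {t : ℝ} (ht : t ≠ 0)
    (v : L) : v ∈ ((A B h2 x₀).eigenspace (-12 / t ^ 2)).map (eigenInit B (x₀ : L) t) ↔
      t • v + (t ^ 2 / 2) • adT B (x₀ : L) v - (t ^ 2 / 2) • ⁅(x₀ : L), v⁆ -
        (t ^ 3 / 6) • ⁅(x₀ : L), adT B (x₀ : L) v⁆ = 0 := by
  set D := adT B (x₀ : L) with hD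
  have hDD : ∀ u, D (D u) = 0 := adT_adT h2 _
  constructor
  · rintro ⟨ζ, hζ, rfl⟩
    have hA : ⁅(x₀ : L), D ζ⁆ = (-12 / t ^ 2) • (ζ : L) :=
      congrArg Subtype.val (Module.End.mem_eigenspace_iff.1 hζ)
    have hc : ⁅(x₀ : L), (ζ : L)⁆ = 0 := ζ.2 _
    rw [eigenInit_apply, ← hD]
    simp only [map_sub, map_smul, hDD, lie_sub, lie_smul, hc, hA, smul_zero, sub_zero]
    match_scalars <;> field_simp <;> ring
  · intro h
    -- Dividing by `t` exhibits this vector as a sum of brackets, hence as central.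
    have hζ : v + (t / 2) • D v =
        (t / 2) • ⁅(x₀ : L), v⁆ + (t ^ 2 / 6) • ⁅(x₀ : L), D v⁆ := by
      rw [← sub_eq_zero, ← smul_eq_zero_iff_right ht, ← h]
      module
    have hcen : v + (t / 2) • D v ∈ centerSub L := by
      rw [hζ]
      exact add_mem (Submodule.smul_mem _ _ (lie_mem_centerSub h2 _ _))
        (Submodule.smul_mem _ _ (lie_mem_centerSub h2 _ _))
    have hc : ⁅(x₀ : L), v⁆ = -((t / 2) • ⁅(x₀ : L), D v⁆) := by
      have := hcen (x₀ : L)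
      rw [lie_add, lie_smul] at this
      exact eq_neg_of_add_eq_zero_left this
    refine ⟨⟨v + (t / 2) • D v, hcen⟩, Module.End.mem_eigenspace_iff.2 (Subtype.ext ?_), ?_⟩
    · change ⁅(x₀ : L), D (v + (t / 2) • D v)⁆ = (-12 / t ^ 2) • (v + (t / 2) • D v)
      have hD' : D (v + (t / 2) • D v) = D v := by
        rw [map_add, map_smul, hDD, smul_zero, add_zero]
      -- The constant `-12` comes from `t²/6 - t²/4 = -t²/12`.
      rw [hD', hζ, hc]
      match_scalars
      field_simp
      ring
    · rw [eigenInit_apply, ← hD, map_add, map_smul, hDD]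
      simp

end MetricLie

/-! ### Jacobi fields in the left trivialization -/

section Group

variable {E : Type*} [NormedAddCommGroup E] [NormedSpace ℝ E] [FiniteDimensional ℝ E]
  {G : Type*} [TopologicalSpace G] [ChartedSpace E G] [Group G] [LieGroup 𝓘(ℝ, E) ∞ G]
  {B : PseudoInner (GroupLieAlgebra 𝓘(ℝ, E) G)} {γ : ℝ → G}

/-- In finite dimension a one-sided linear inverse is two-sided. -/
theorem leftPush_leftTriv (g : G) (v : TangentSpace 𝓘(ℝ, E) g) :
    leftPush g (leftTriv g v) = v := by
  let P : E →ₗ[ℝ] E :=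
    { toFun := leftPush g
      map_add' := leftPush_add g
      map_smul' := leftPush_smul g }
  have hP : Function.Injective P := Function.LeftInverse.injective (leftTriv_leftPush g)
  obtain ⟨u, hu⟩ := (LinearMap.injective_iff_surjective.1 hP) v
  have hu' : leftPush g (u : GroupLieAlgebra 𝓘(ℝ, E) G) = v := hu
  rw [← hu']
  exact congrArg (leftPush g) (leftTriv_leftPush g u)

theorem leftTriv_eq_zero_iff {g : G} {v : TangentSpace 𝓘(ℝ, E) g} : leftTriv g v = 0 ↔ v = 0 := by
  refine ⟨fun h => ?_, fun h => by rw [h, map_zero]⟩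
  exact Function.LeftInverse.injective (leftPush_leftTriv g) (h.trans (map_zero _).symm)

/-- The acceleration `ad†_ω ω` is orthogonal to the center, so `ω - z` stays in `𝔳`. The equation is
then the linear one `ω' = jExt B z ω`, for which `z + x` is an equilibrium. -/
theorem triv_velocity_eq (h2 : IsTwoStepNilpotent (GroupLieAlgebra 𝓘(ℝ, E) G))
    (hγ : IsGeodesic B γ) {z x : GroupLieAlgebra 𝓘(ℝ, E) G}
    (hz : z ∈ centerSub (GroupLieAlgebra 𝓘(ℝ, E) G)) (hx : x ∈ vSub B)
    (h0 : triv (velocity E γ) 0 = z + x) (hJ : jExt B z x = 0) (t : ℝ) :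
    triv (velocity E γ) t = z + x := by
  have hd : ∀ s, HasDerivAt (F := E) (triv (velocity E γ))
      (adT B (triv (velocity E γ) s) (triv (velocity E γ) s)) s := by
    intro s
    refine (hasDerivAt_of_contDiff (E := E) hγ.2.1 s).congr_deriv ?_
    have h := congrArg (leftTriv (γ s)) (hγ.2.2 s)
    have h' : deriv (triv (velocity E γ)) s +
        nabla B (triv (velocity E γ) s) (triv (velocity E γ) s) = 0 := by
      rw [← triv_covDeriv]
      exact h.trans (map_zero _)
    rw [nabla_self, ← sub_eq_add_neg, sub_eq_zero] at h'
    exact h'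
  have hv : ∀ s, triv (velocity E γ) s - z ∈ vSub B := by
    intro s n hn
    let ℓ : E →ₗ[ℝ] ℝ := B.form n
    have hℓ : ∀ r, HasDerivAt (fun r => ℓ (triv (velocity E γ) r)) 0 r := by
      intro r
      refine ((LinearMap.toContinuousLinearMap ℓ).hasFDerivAt.comp_hasDerivAt r
        (hd r)).congr_deriv ?_
      exact adT_mem_vSub B _ _ n hn
    have hc : B.form n (triv (velocity E γ) s) = B.form n (triv (velocity E γ) 0) :=
      is_const_of_deriv_eq_zero (fun r => (hℓ r).differentiableAt) (fun r => (hℓ r).deriv) s 0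
    change B.form n (triv (velocity E γ) s - z) = 0
    rw [map_sub, hc, h0, map_add, add_sub_cancel_left]
    exact hx n hn
  have hlin : ∀ s, HasDerivAt (F := E) (triv (velocity E γ))
      (jExt B z (triv (velocity E γ) s)) s := by
    intro s
    rw [← adT_self_of_decomp h2 (hv s) (by abel)]
    exact hd s
  have hzx : jExt B z (z + x) = 0 := by
    rw [map_add, hJ, jExt_apply, adT_center hz, add_zero]
  refine congrFun (eq_of_linear_ode (E := E) (jExt B z) (g := fun _ => z + x) hlin (fun s => ?_)
    h0) t
  refine (hasDerivAt_const s _).congr_deriv ?_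
  exact hzx.symm

theorem isJacobi_iff (h2 : IsTwoStepNilpotent (GroupLieAlgebra 𝓘(ℝ, E) G))
    {z x : GroupLieAlgebra 𝓘(ℝ, E) G}
    (hz : z ∈ centerSub (GroupLieAlgebra 𝓘(ℝ, E) G)) (hx : x ∈ vSub B)
    (hv : ∀ t, triv (velocity E γ) t = z + x) (hJ : jExt B z x = 0) (Y : FieldAlong E γ) :
    IsJacobi B Y ↔ JacobiSystem (E := E) (LieAlgebra.ad ℝ (GroupLieAlgebra 𝓘(ℝ, E) G) x)
      (jExt B z + adT B x) (triv Y) := by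
  let y : ℝ → E := triv Y
  let n : E →ₗ[ℝ] E := nabla B (z + x)
  let a : E →ₗ[ℝ] E := LieAlgebra.ad ℝ (GroupLieAlgebra 𝓘(ℝ, E) G) x
  let F : E →ₗ[ℝ] E := jExt B z + adT B x
  have h1 : (triv (covDeriv B Y) : ℝ → E) = fun r => deriv y r + n (y r) := by
    funext r
    refine (triv_covDeriv B Y r).trans ?_
    rw [hv]
    rfl
  refine ⟨fun h => ⟨h.1, fun s => ?_⟩, fun h => ⟨h.contDiff, fun s => ?_⟩⟩
  all_goals
    have hy : ContDiff ℝ ∞ y := h.1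
    have d1 := hasDerivAt_of_contDiff hy s
    have d2 := hasDerivAt_of_contDiff (contDiff_deriv hy) s
    have d3 : deriv (triv (covDeriv B Y)) s = deriv (deriv y) s + n (deriv y s) := by
      refine Eq.trans ?_ (d2.add (hasDerivAt_linearMap n d1)).deriv
      exact congrArg (fun f : ℝ → E => deriv f s) h1
    have d4 : HasDerivAt (fun r => deriv y r + a (y r)) (deriv (deriv y) s + a (deriv y s)) s :=
      d2.add (hasDerivAt_linearMap a d1)
    -- This identity holds for any smooth field, so it serves both implications.
    have key : @Eq E (leftTriv (γ s) (covDeriv B (covDeriv B Y) s +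
        curvAt B (γ s) (Y s) (velocity E γ s) (velocity E γ s)))
        ((deriv (deriv y) s + a (deriv y s)) - F (deriv y s + a (y s))) := by
      refine Eq.trans ?_ (jacobi_algebra h2 hz hx hJ (y s) (deriv y s) (deriv (deriv y) s))
      rw [map_add, curvAt, leftTriv_leftPush]
      refine congrArg₂ (· + ·) ?_ ?_
      · refine (triv_covDeriv B _ s).trans ?_
        rw [hv, d3]
        exact congrArg (fun u => _ + nabla B (z + x) u) (congrFun h1 s)
      · have := hv s
        rw [triv] at this
        rw [this]
        rfl
  · refine d4.congr_deriv ?_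
    exact sub_eq_zero.1
      (key.symm.trans ((congrArg (leftTriv (γ s)) (h.2 s)).trans (map_zero _)))
  · exact leftTriv_eq_zero_iff.1 (key.trans (sub_eq_zero.2 (d4.unique (h.hasDerivAt s))))

/-- The initial derivative of a Jacobi field, in the left trivialization. -/
def jacobiInit (hγ : IsGeodesic B γ) (t : ℝ) : jacobiVanishing B hγ t →ₗ[ℝ] E where
  toFun Y := deriv (F := E) (triv Y.1) 0
  map_add' Y Z := by
    have h : (triv (Y + Z).1 : ℝ → E) = fun s => (triv Y.1 s + triv Z.1 s : E) :=
      triv_add Y.1 Z.1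
    rw [h]
    exact deriv_add (F := E) (Y.2.1.1.differentiableAt 0) (Z.2.1.1.differentiableAt 0)
  map_smul' c Y := by
    have h : (triv (c • Y).1 : ℝ → E) = fun s => (c • triv Y.1 s : E) :=
      triv_smul c Y.1
    rw [h]
    exact deriv_const_smul (F := E) c (Y.2.1.1.differentiableAt 0)

theorem triv_eq_zero_iff {Y : FieldAlong E γ} {t : ℝ} : triv Y t = 0 ↔ Y t = 0 :=
  leftTriv_eq_zero_iff

theorem exists_triv_eq (γ : ℝ → G) (y : ℝ → E) : ∃ Y : FieldAlong E γ, triv Y = y :=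
  ⟨fun t => leftPush (γ t) (y t), funext fun t => leftTriv_leftPush (γ t) (y t)⟩

/-- The initial derivative maps the Jacobi fields vanishing at both ends isomorphically onto `W`;
what remains in each case is to compute `W`. -/
theorem jacobi_multiplicity (h2 : IsTwoStepNilpotent (GroupLieAlgebra 𝓘(ℝ, E) G))
    (hγ : IsGeodesic B γ) {z x : GroupLieAlgebra 𝓘(ℝ, E) G}
    (hz : z ∈ centerSub (GroupLieAlgebra 𝓘(ℝ, E) G)) (hx : x ∈ vSub B)
    (h0 : triv (velocity E γ) 0 = z + x) (hJ : jExt B z x = 0) (t : ℝ) (W : Submodule ℝ E)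
    (hW : ∀ v, v ∈ W ↔ ∃ y, JacobiSystem (E := E)
      (LieAlgebra.ad ℝ (GroupLieAlgebra 𝓘(ℝ, E) G) x) (jExt B z + adT B x) y ∧
        y 0 = 0 ∧ y t = 0 ∧ deriv y 0 = v) :
    multCP B hγ t = Module.finrank ℝ W ∧ (IsConjugate B γ t ↔ t ≠ 0 ∧ W ≠ ⊥) := by
  have hv := triv_velocity_eq h2 hγ hz hx h0 hJ
  have hj := isJacobi_iff h2 hz hx hv hJ
  have hinj : Function.Injective (jacobiInit hγ t) := by
    rw [injective_iff_map_eq_zero]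
    intro Y hY
    have h := ((hj Y.1).1 Y.2.1).eq_zero (triv_eq_zero_iff.2 Y.2.2.1) hY
    exact Subtype.ext (funext fun s => triv_eq_zero_iff.1 (h s))
  have hr : LinearMap.range (jacobiInit hγ t) = W := by
    ext v
    rw [hW, LinearMap.mem_range]
    constructor
    · rintro ⟨Y, rfl⟩
      exact ⟨triv Y.1, (hj Y.1).1 Y.2.1, triv_eq_zero_iff.2 Y.2.2.1, triv_eq_zero_iff.2 Y.2.2.2,
        rfl⟩
    · rintro ⟨y, hy, hy0, hyt, rfl⟩
      obtain ⟨Y, rfl⟩ := exists_triv_eq γ y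
      exact ⟨⟨Y, (hj Y).2 hy, triv_eq_zero_iff.1 hy0, triv_eq_zero_iff.1 hyt⟩, rfl⟩
  refine ⟨?_, and_congr_right fun _ => ?_⟩
  · rw [← hr, LinearMap.finrank_range_of_inj hinj, multCP]
  · rw [← hr, ne_eq, LinearMap.range_eq_bot]
    constructor
    · rintro ⟨Y, hY, hne, hY0, hYt⟩ h
      have := hinj (a₁ := ⟨Y, hY, hY0, hYt⟩) (a₂ := 0) (by rw [h]; rfl)
      exact hne (congrArg Subtype.val this)
    · intro h
      by_contra hcon
      refine h (LinearMap.ext fun Y => ?_)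
      have : Y = 0 := by
        by_contra hY
        exact hcon ⟨Y.1, Y.2.1, fun h => hY (Subtype.ext h), Y.2.2⟩
      rw [this, map_zero, map_zero]

end Group

/-! ### Conjugate points for `J = 0` and for central initial velocity -/

section Cases

variable {E : Type*} [NormedAddCommGroup E] [NormedSpace ℝ E] [FiniteDimensional ℝ E]
  {G : Type*} [TopologicalSpace G] [ChartedSpace E G] [Group G] [LieGroup 𝓘(ℝ, E) ∞ G]
  {B : PseudoInner (GroupLieAlgebra 𝓘(ℝ, E) G)} {γ : ℝ → G}

/-- Conjugate points when `J = 0`. -/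
theorem conjugate_of_J_eq_zero (h2 : IsTwoStepNilpotent (GroupLieAlgebra 𝓘(ℝ, E) G))
    (hz : NondegenerateCenter B) (hγ : IsGeodesic B γ)
    (z₀ : centerSub (GroupLieAlgebra 𝓘(ℝ, E) G)) (x₀ : vSub B)
    (hγ' : triv (velocity E γ) 0 =
      (z₀ : GroupLieAlgebra 𝓘(ℝ, E) G) + (x₀ : GroupLieAlgebra 𝓘(ℝ, E) G))
    (hJ : J B z₀ = 0) {t : ℝ} (ht : t ≠ 0) :
    (IsConjugate B γ t ↔ (A B h2 x₀).HasEigenvalue (-12 / t ^ 2)) ∧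
      multCP B hγ t = multEV (A B h2 x₀) (-12 / t ^ 2) := by
  have hj := jExt_eq_zero_of_J hz hJ
  have key := jacobi_multiplicity h2 hγ z₀.2 x₀.2 hγ' (by rw [hj]; rfl) t
    (((A B h2 x₀).eigenspace (-12 / t ^ 2)).map
      (eigenInit B (x₀ : GroupLieAlgebra 𝓘(ℝ, E) G) t)) (fun v => by
        rw [hj, zero_add]
        exact (mem_map_eigenInit_iff h2 x₀ ht v).trans
          (exists_jacobiSystem_iff_cubicSol (E := E)
            (a := LieAlgebra.ad ℝ (GroupLieAlgebra 𝓘(ℝ, E) G) x₀) (d := adT B x₀)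
            (fun u => h2 _ _ u) (adT_adT h2 (x₀ : GroupLieAlgebra 𝓘(ℝ, E) G)) t v).symm)
  exact ⟨key.2.trans ((and_iff_right ht).trans (map_eigenInit_eq_bot_iff h2 _ t _).not),
    key.1.trans (finrank_map_eigenInit h2 _ t _)⟩

/-- Conjugate points when the initial velocity is central. -/
theorem conjugate_of_central (h2 : IsTwoStepNilpotent (GroupLieAlgebra 𝓘(ℝ, E) G))
    (hγ : IsGeodesic B γ) (z₀ : centerSub (GroupLieAlgebra 𝓘(ℝ, E) G))
    (hγ' : triv (velocity E γ) 0 = (z₀ : GroupLieAlgebra 𝓘(ℝ, E) G))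
    {ι : Type*} (lam : ι → ℝ) (hpos : ∀ k, 0 < lam k) (hinj : Function.Injective lam)
    (hlam : ∀ μ : ℝ, (μ < 0 ∧ (J B z₀ ^ 2).HasEigenvalue μ) ↔ ∃ k, μ = -lam k ^ 2)
    {t : ℝ} (ht : t ≠ 0) (s : Finset ι)
    (hs : ∀ k, k ∈ s ↔ ∃ m : ℤ, lam k * t = 2 * Real.pi * m) :
    (IsConjugate B γ t ↔ s.Nonempty) ∧
      multCP B hγ t = ∑ k ∈ s, multEV (J B z₀ ^ 2) (-lam k ^ 2) := by
  let T : E →ₗ[ℝ] E := jExt B (z₀ : GroupLieAlgebra 𝓘(ℝ, E) G)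
  have hT : ∀ μ : ℝ, (μ < 0 ∧ (T ^ 2 : Module.End ℝ E).HasEigenvalue μ) ↔
      ∃ k, μ = -lam k ^ 2 := fun μ => by
    rw [← hlam]
    exact and_congr_right fun h => (hasEigenvalue_J_sq_iff z₀ h.ne).symm
  have key := jacobi_multiplicity h2 hγ z₀.2 (zero_mem (vSub B)) (hγ'.trans (add_zero _).symm)
    (map_zero _) t (LinearMap.range (returnInit T t)) (fun v => by
      have h1 : adT B (0 : GroupLieAlgebra 𝓘(ℝ, E) G) = 0 :=
        LinearMap.ext fun u => adT_center (zero_mem _) u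
      rw [h1, add_zero, map_zero]
      exact (exists_jacobiSystem_iff_mem_range T t v).symm)
  -- The initial velocities now form a sum of eigenspaces over the resonant indices, each of them
  -- nonzero.
  rw [range_returnInit_eq_biSup ht lam hpos hT s hs] at key
  have hne : Function.Injective fun k => -lam k ^ 2 := fun k l h => by
    have h' : lam k ^ 2 = lam l ^ 2 := neg_inj.1 h
    exact hinj ((sq_eq_sq₀ (hpos k).le (hpos l).le).1 h')
  refine ⟨key.2.trans ?_, key.1.trans ?_⟩
  · rw [and_iff_right ht, ne_eq, iSup₂_eq_bot]
    constructor
    · intro h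
      by_contra hcon
      rw [Finset.not_nonempty_iff_eq_empty] at hcon
      exact h fun k hk => by simp [hcon] at hk
    · rintro ⟨k, hk⟩ h
      exact ((hT (-lam k ^ 2)).2 ⟨k, rfl⟩).2 (h k hk)
  · rw [finrank_biSup_eigenspace _ hne]
    exact Finset.sum_congr rfl fun k _ =>
      (multEV_J_sq z₀ (neg_ne_zero.2 (pow_pos (hpos k) 2).ne')).symm

/-- Divisibility by `a / n` is resonance of the frequency `b` at time `2πn/a`; the multiple is
nonzero because `b` is. -/
theorem realDvd_iff {a b : ℝ} (ha : 0 < a) (hb : 0 < b) {n : ℤ} (hn : n ≠ 0) :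
    RealDvd (a / n) b ↔ ∃ m : ℤ, b * (2 * Real.pi / a * n) = 2 * Real.pi * m := by
  have hn' : (n : ℝ) ≠ 0 := Int.cast_ne_zero.2 hn
  have hpi := Real.pi_ne_zero
  have ha' := ha.ne'
  constructor
  · rintro ⟨m, _, rfl⟩
    refine ⟨m, ?_⟩
    field_simp
  · rintro ⟨m, hm⟩
    have h : b = m * (a / n) := by
      field_simp at hm ⊢
      linarith
    refine ⟨m, ?_, h⟩
    rintro rfl
    simp [hb.ne'] at h

end Cases

end NilConj

end

/-! ### The three cases of the theorem -/

open NilConj in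
open scoped Classical in
theorem theorem2
    {E : Type*} [NormedAddCommGroup E] [NormedSpace ℝ E] [FiniteDimensional ℝ E]
    {N : Type*} [TopologicalSpace N] [ChartedSpace E N] [Group N] [LieGroup 𝓘(ℝ, E) ∞ N]
    (h2 : IsTwoStepNilpotent (GroupLieAlgebra 𝓘(ℝ, E) N))
    (B : PseudoInner (GroupLieAlgebra 𝓘(ℝ, E) N))
    (hz : NondegenerateCenter B)
    (γ : ℝ → N) (hγ : IsGeodesic B γ) (hγ0 : γ 0 = 1)
    (z₀ : centerSub (GroupLieAlgebra 𝓘(ℝ, E) N)) (x₀ : vSub B)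
    (hγ' : triv (velocity E γ) 0 =
      (z₀ : GroupLieAlgebra 𝓘(ℝ, E) N) + (x₀ : GroupLieAlgebra 𝓘(ℝ, E) N)) :
    (J B z₀ = 0 → x₀ = 0 → ∀ t : ℝ, ¬ IsConjugate B γ t) ∧
    (J B z₀ = 0 → x₀ ≠ 0 → ∀ t : ℝ, t ≠ 0 →
      (IsConjugate B γ t ↔ (A B h2 x₀).HasEigenvalue (-12 / t ^ 2)) ∧
      multCP B hγ t = multEV (A B h2 x₀) (-12 / t ^ 2) ∧
      multEV (A B h2 x₀) (-12 / t ^ 2) ≤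
        Module.finrank ℝ (centerSub (GroupLieAlgebra 𝓘(ℝ, E) N))) ∧
    (J B z₀ ≠ 0 → x₀ = 0 → ∀ (q : ℕ) (lam : Fin q → ℝ),
      (∀ k, 0 < lam k) → Function.Injective lam →
      (∀ μ : ℝ, (μ < 0 ∧ (J B z₀ ^ 2).HasEigenvalue μ) ↔ ∃ k, μ = -lam k ^ 2) →
      (∀ t : ℝ, IsConjugate B γ t ↔ ∃ (k : Fin q) (n : ℤ), n ≠ 0 ∧ t = 2 * Real.pi / lam k * n) ∧
      ∀ (k : Fin q) (n : ℤ), n ≠ 0 →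
        multCP B hγ (2 * Real.pi / lam k * n) =
          ∑ h : Fin q with RealDvd (lam k / n) (lam h), multEV (J B z₀ ^ 2) (-lam h ^ 2) ∧
        ∑ h : Fin q with RealDvd (lam k / n) (lam h), multEV (J B z₀ ^ 2) (-lam h ^ 2) ≤
          Module.finrank ℝ (vSub B)) := by
  refine ⟨fun hJ hx₀ t => ?_, fun hJ _ t ht => ?_, fun _ hx₀ q lam hpos hinj hlam => ?_⟩
  · intro hc
    have ht := hc.1
    subst hx₀
    have h := ((conjugate_of_J_eq_zero h2 hz hγ z₀ 0 hγ' hJ ht).1.1 hc).exists_hasEigenvector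
    obtain ⟨ζ, hζ, hζ0⟩ := h
    -- For `x₀ = 0` the operator `A` is zero, while `-12/t²` is not.
    have h0 : A B h2 0 ζ = 0 := Subtype.ext (zero_lie _)
    rw [Module.End.mem_eigenspace_iff, h0, eq_comm, smul_eq_zero] at hζ
    exact hζ.elim (div_ne_zero (by norm_num) (pow_ne_zero 2 ht)) hζ0
  · have h := conjugate_of_J_eq_zero h2 hz hγ z₀ x₀ hγ' hJ ht
    exact ⟨h.1, h.2, Submodule.finrank_le _⟩
  · subst hx₀
    have hγ₁ : triv (velocity E γ) 0 = (z₀ : GroupLieAlgebra 𝓘(ℝ, E) N) :=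
      hγ'.trans (add_zero _)
    have hpi := Real.pi_ne_zero
    refine ⟨fun t => ?_, fun k n hn => ?_⟩
    · rcases eq_or_ne t 0 with rfl | ht
      · refine iff_of_false (fun h => h.1 rfl) ?_
        rintro ⟨k, n, hn, h⟩
        have := (hpos k).ne'
        have hn' : (n : ℝ) ≠ 0 := Int.cast_ne_zero.2 hn
        exact (mul_ne_zero (div_ne_zero (mul_ne_zero two_ne_zero hpi) this) hn') h.symm
      · rw [(conjugate_of_central h2 hγ z₀ hγ₁ lam hpos hinj hlam ht
          {k | ∃ m : ℤ, lam k * t = 2 * Real.pi * m} (by simp)).1]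
        constructor
        · rintro ⟨k, hk⟩
          obtain ⟨m, hm⟩ := (Finset.mem_filter.1 hk).2
          have hk' := (hpos k).ne'
          refine ⟨k, m, ?_, ?_⟩
          · rintro rfl
            simp [hk', ht] at hm
          · field_simp
            linarith
        · rintro ⟨k, m, -, rfl⟩
          have hk' := (hpos k).ne'
          exact ⟨k, Finset.mem_filter.2 ⟨Finset.mem_univ _, m, by field_simp⟩⟩
    · have hn' : (n : ℝ) ≠ 0 := Int.cast_ne_zero.2 hn
      have ht : 2 * Real.pi / lam k * n ≠ 0 :=
        mul_ne_zero (div_ne_zero (mul_ne_zero two_ne_zero hpi) (hpos k).ne') hn'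
      refine ⟨(conjugate_of_central h2 hγ z₀ hγ₁ lam hpos hinj hlam ht _ fun h => ?_).2, ?_⟩
      · simp only [Finset.mem_filter, Finset.mem_univ, true_and]
        exact realDvd_iff (hpos k) (hpos h) hn
      · have hne : Function.Injective fun k => -lam k ^ 2 := fun k l h => by
          have h' : lam k ^ 2 = lam l ^ 2 := neg_inj.1 h
          exact hinj ((sq_eq_sq₀ (hpos k).le (hpos l).le).1 h')
        -- The sum is the dimension of a subspace of `𝔳`.
        rw [← finrank_biSup_eigenspace _ hne]
        exact Submodule.finrank_le _
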